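/- **Model.** There are $n$ servers and a totally ordered set $K$ of values; initially every server stores an arbitrary value of $K$. Time proceeds in synchronous rounds. In each round an adversary blocks a set of servers; blocked servers neither send nor receive messages in that round. In the *$(6,3)$-median rule*, every server $i$ does the following in each round: it sends $6$ value requests to servers chosen independently and uniformly at random (with repetition, itself included); a request is answered if and only if neither the requesting nor the requested server is blocked and the requested server currently stores a value (rather than the undecided state $\bot$), and the answer is that value. If $i$ receives at least $3$ replies, it picks a uniformly random $3$-element subset of them and adopts the median of their values; otherwise its state becomes $\bot$. A server is *useful* in a round if it stores a value (not $\bot$) at the beginning of the round and is not blocked during the round. The adversary is *1-late* if its (possibly randomized) choice of the servers to block in round $r$ depends only on the local states of the servers, including their random choices, up to the beginning of round $r-1$ (and on its own independent randomness). It is *$\beta$-blocking* if in every round it blocks at most $\beta n$ servers. **Theorem.** 1. For every $c>0$ there are $C>0$ and $n_0$ such that for all $n\ge n_0$, all $K$, all initial values and all 1-late adversaries (with no bound on the number of blocked servers), with probability at least $1-n^{-c}$ the following holds: for every $T\ge C\log n$ such that at least $n/4$ servers are useful in each round up to round $T$, the execution solves stabilizing consensus, i.e. * (agreement) there is a value $v\in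 K$ such that from time $C\log n$ on, forever, every useful server holds $v$; * (availability) at least a constant fraction ($1/4$) of the servers is useful in each round up to round $T$; * (validity) whenever a server stores a value at the end of a round, some server stored that value at the beginning of that round. In particular, if at least $n/4$ servers are useful in each round, the $(6,3)$-median rule solves stabilizing consensus in $O(\log n)$ rounds, w.h.p. 2. For every $c>0$ and $d\in\mathbb{N}$ there is $n_0$ such that for all $n\ge n_0$, all $K$, all initial values and all 1-late $1/10$-blocking adversaries, with probability at least $1-n^{-c}$ at least $\tfrac34 n$ servers are useful in each of the first $n^d$ rounds. -/

import Mathlib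

open MeasureTheory

namespace MedianConsensus

/-! ### The random choices of the servers -/

/-- The random choices that one server makes in one round of the `(k, ℓ)`-median rule with `n`
servers: the targets of its `k` value requests (repetitions and the server itself are possible
targets), and, for each possible set `A` of at least `ℓ` answered requests, the `ℓ`-element subset
of `A` that the server uses in case that exactly the requests in `A` are answered. -/
def Choice (n k ℓ : ℕ) : Type :=
  (Fin k → Fin n) ×
    ((A : {A : Finset (Fin k) // ℓ ≤ A.card}) → {L : Finset (Fin k) // L ⊆ A.1 ∧ L.card = ℓ})

instance (n k ℓ : ℕ) : Fintype (Choice n k ℓ) :=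
  inferInstanceAs (Fintype ((Fin k → Fin n) ×
    ((A : {A : Finset (Fin k) // ℓ ≤ A.card}) → {L : Finset (Fin k) // L ⊆ A.1 ∧ L.card = ℓ})))

instance (n k ℓ : ℕ) [NeZero n] : Nonempty (Choice n k ℓ) :=
  ⟨(fun _ => 0, fun A =>
    ⟨(Finset.exists_subset_card_eq A.2).choose, (Finset.exists_subset_card_eq A.2).choose_spec⟩)⟩

instance (n k ℓ : ℕ) : MeasurableSpace (Choice n k ℓ) := ⊤

/-- All random choices of all servers: `ω t i` is the choice of server `i` in round `t`.
Rounds are numbered `0, 1, 2, …`. -/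
abbrev Outcome (n k ℓ : ℕ) : Type := ℕ → Fin n → Choice n k ℓ

/-- All choices are uniform, and independent over the rounds and the servers. (Uniformity on
`Choice` makes the `k` targets independent and uniform, and makes the used subset uniform among
the `ℓ`-subsets of the set of answered requests.) -/
noncomputable def choiceLaw (n k ℓ : ℕ) [NeZero n] : Measure (Outcome n k ℓ) :=
  Measure.infinitePi fun _ : ℕ => Measure.pi fun _ : Fin n =>
    (PMF.uniformOfFintype (Choice n k ℓ)).toMeasure

/-! ### The `(k, ℓ)`-median rule -/

/-- The median of a multiset of odd size: the middle element in sorted order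
(`none` for the empty multiset). -/
noncomputable def median {K : Type*} [LinearOrder K] (s : Multiset K) : Option K :=
  (s.sort (· ≤ ·))[s.card / 2]?

/-- The reply that server `i` gets to a request sent to server `j`, when the servers in `B` are
blocked and `x` holds the stored values (`none` is the undecided state `⊥`): there is a reply
exactly if neither `i` nor `j` is blocked and `j` stores a value. -/
def reply {K : Type*} {n : ℕ} (B : Finset (Fin n)) (x : Fin n → Option K) (i j : Fin n) :
    Option K :=
  if i ∈ B ∨ j ∈ B then none else x j

/-- The new state of a server with random choice `c`, where `ρ j` is the reply to its `j`-th
request: the median of the chosen `ℓ` replies if there are at least `ℓ` replies, and `⊥`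
otherwise. -/
noncomputable def newValue {K : Type*} [LinearOrder K] {n k ℓ : ℕ} (c : Choice n k ℓ)
    (ρ : Fin k → Option K) : Option K :=
  if h : ℓ ≤ (Finset.univ.filter fun j => (ρ j).isSome).card then
    median ((c.2 ⟨_, h⟩).1.val.filterMap ρ)
  else none

/-- The states at the beginning of the rounds: `state x₀ B ω t i` is the value (or `⊥`) of server
`i` at the beginning of round `t`, if initially server `i` stores `x₀ i`, the servers in `B t` are
blocked in round `t`, and `ω` are the random choices. -/
noncomputable def state {K : Type*} [LinearOrder K] {n k ℓ : ℕ} (x₀ : Fin n → K)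
    (B : ℕ → Finset (Fin n)) (ω : Outcome n k ℓ) : ℕ → Fin n → Option K
  | 0 => fun i => some (x₀ i)
  | t + 1 => fun i =>
      newValue (ω t i) fun j => reply (B t) (state x₀ B ω t) i ((ω t i).1 j)

/-- The servers that are useful in round `t`: those that store a value at the beginning of round
`t` and are not blocked during round `t`. -/
def useful {K : Type*} {n : ℕ} (x : ℕ → Fin n → Option K) (B : ℕ → Finset (Fin n)) (t : ℕ) :
    Finset (Fin n) :=
  Finset.univ.filter fun i => i ∉ B t ∧ (x t i).isSome

/-! ### The adversary -/

/-- A blocking adversary against the `(k, ℓ)`-median rule: it blocks the set `block s ω t` in round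
`t`, where `s` is its own random seed and `ω` are the choices of the servers. Since the states are
determined by `ω` and the blocked sets, what the adversary may know is expressed through `ω`. -/
structure Adversary (S : Type*) [MeasurableSpace S] (n k ℓ : ℕ) where
  block : S → Outcome n k ℓ → ℕ → Finset (Fin n)
  measurable_block : ∀ ω t B, MeasurableSet {s | block s ω t = B}

/-- The adversary is `α`-late: its decision for round `t` depends only on what has happened up to
the beginning of round `t - α`, that is, on the choices made in the rounds before `t - α`. -/
def Adversary.IsLate {S : Type*} [MeasurableSpace S] {n k ℓ : ℕ} (A : Adversary S n k ℓ)
    (α : ℕ) : Prop :=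
  ∀ s t ω ω', (∀ r, r + α < t → ω r = ω' r) → A.block s ω t = A.block s ω' t

/-- The adversary is `β`-blocking: it never blocks more than a `β`-fraction of the servers. -/
def Adversary.IsBlocking {S : Type*} [MeasurableSpace S] {n k ℓ : ℕ} (A : Adversary S n k ℓ)
    (β : ℝ) : Prop :=
  ∀ s ω t, ((A.block s ω t).card : ℝ) ≤ β * n

/-- The states of the `(k, ℓ)`-median rule against the adversary `A` with initial values `x₀`, where
`p` consists of the random seed of the adversary and the random choices of the servers. -/
noncomputable def Adversary.states {S : Type*} [MeasurableSpace S] {n k ℓ : ℕ}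
    (A : Adversary S n k ℓ) {K : Type*} [LinearOrder K] (x₀ : Fin n → K)
    (p : S × Outcome n k ℓ) : ℕ → Fin n → Option K :=
  state x₀ (A.block p.1 p.2) p.2

/-- The sets of useful servers in this execution. -/
noncomputable def Adversary.usefulSets {S : Type*} [MeasurableSpace S] {n k ℓ : ℕ}
    (A : Adversary S n k ℓ) {K : Type*} [LinearOrder K] (x₀ : Fin n → K)
    (p : S × Outcome n k ℓ) : ℕ → Finset (Fin n) :=
  useful (A.states x₀ p) (A.block p.1 p.2)

/-! ### Stabilizing consensus -/

/-- The run with states `x` and useful sets `U` satisfies the requirements of the stabilizing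
consensus problem, with agreement reached within `τ` rounds, and with at least a `δ`-fraction of
the servers useful in all rounds up to round `T`. -/
structure SolvesStabilizingConsensus {K : Type*} {n : ℕ} (x : ℕ → Fin n → Option K)
    (U : ℕ → Finset (Fin n)) (τ δ : ℝ) (T : ℕ) : Prop where
  /-- From time `τ` on, forever, all useful servers hold the same value. -/
  agreement : ∃ v : K, ∀ t : ℕ, τ ≤ t → ∀ i ∈ U t, x t i = some v
  /-- In each of the considered rounds at least a `δ`-fraction of the servers is useful. -/
  availability : ∀ t ≤ T, δ * n ≤ ((U t).card : ℝ)
  /-- A value stored at the end of a round was stored by some server at its beginning. -/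
  validity : ∀ t i v, x (t + 1) i = some v → ∃ j, x t j = some v

end MedianConsensus

/-!
The proof rests on one observation about lateness: given the choices before round `t`, the states
at the beginning of round `t` and the sets blocked in rounds `t` and `t + 1` are all fixed, while
the choices of round `t` are still fresh. Hence, given the set of servers that are useful in round
`t + 1`, their values are independent, and each is the median of three uniform samples from the
values of the servers useful in round `t` (`card_newValue_le`, `sum_binomialMean`). The adversary
only influences how many samples are drawn.

*Agreement.* A median commutes with monotone maps, so for each threshold `v` the set of useful
servers with a value at most `v` evolves by a majority-of-three rule, under which a fraction `p`
becomes `3 p ^ 2 - 2 p ^ 3` on average. In terms of the deviation `δ = p - 1 / 2`, consider the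
potential `(1 - 4 δ ^ 2) / (κ + δ ^ 2)` with `κ = 100 / n`. While at least `n / 4` servers are
useful, a round shrinks it by a constant factor in expectation (`binomialMean_potential_le`): for
large `δ` because the minority shrinks, for moderate `δ` because `δ` grows by a factor near
`3 / 2`, and for `δ` near `0` because the sampling noise increases `δ ^ 2`. The estimate is uniform in
`δ`: the potential is affine in `1 / (κ + δ ^ 2)`, and a second-order expansion reduces the
estimate to the second and fourth moments of the binomial distribution. The potential is at most
`n`, and at least `4 / n ^ 2` as long as the threshold separates two useful servers; so by
Markov's inequality and a union bound over the at most `n` initial values, disagreement after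
`C log n` rounds has probability at most `n ^ (-c)`. Agreement then lasts forever
(`agreement_persists`).

*Availability.* If `3 / 4` of the servers are useful and at most `1 / 10` are blocked in each of
two successive rounds, then each of the at least `4 / 5 * n` servers unblocked in both gets fewer
than three replies with probability at most `15 / 256`, and an exponential-moment bound
(`exists_card_few_active_le`) makes the loss of availability exponentially unlikely in each round.
-/

namespace MedianConsensus

/-! ### Contraction of the potential under binomial sampling -/

/-- The expectation of `f X`, where `X` is binomial with `m` trials of success probability `g`.
The recursion conditions on one of the trials, which lets statements about it be proved by plain
induction on `m`, without binomial coefficients. -/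
noncomputable def binomialMean (g : ℝ) : ℕ → (ℕ → ℝ) → ℝ
  | 0, f => f 0
  | m + 1, f => g * binomialMean g m (fun k => f (k + 1)) + (1 - g) * binomialMean g m f

theorem binomialMean_mono {g : ℝ} (h0 : 0 ≤ g) (h1 : g ≤ 1) (m : ℕ) {f h : ℕ → ℝ}
    (hfh : ∀ k, f k ≤ h k) : binomialMean g m f ≤ binomialMean g m h := by
  induction m generalizing f h with
  | zero => exact hfh 0
  | succ m ih =>
    exact add_le_add (mul_le_mul_of_nonneg_left (ih fun k => hfh _) h0)
      (mul_le_mul_of_nonneg_left (ih hfh) (by linarith))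

theorem binomialMean_linear (g : ℝ) (m : ℕ) (α β γ : ℝ) (f h : ℕ → ℝ) :
    binomialMean g m (fun k => α + β * f k + γ * h k) =
      α + β * binomialMean g m f + γ * binomialMean g m h := by
  induction m generalizing f h with
  | zero => rfl
  | succ m ih =>
    simp only [binomialMean]
    rw [ih (fun k => f (k + 1)) (fun k => h (k + 1)), ih f h]
    ring

/-- The second moment around an arbitrary point `m * g - z`; having all `z` at once makes the
induction go through. -/
theorem binomialMean_sq (g : ℝ) (m : ℕ) (z : ℝ) :
    binomialMean g m (fun k => ((k : ℝ) - m * g + z) ^ 2) = z ^ 2 + m * (g * (1 - g)) := by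
  induction m generalizing z with
  | zero => simp [binomialMean]
  | succ m ih =>
    have e1 : (fun k : ℕ => (((k + 1 : ℕ) : ℝ) - ((m + 1 : ℕ) : ℝ) * g + z) ^ 2) =
        fun k : ℕ => ((k : ℝ) - m * g + (z + 1 - g)) ^ 2 := by
      funext k; push_cast; ring
    have e2 : (fun k : ℕ => ((k : ℝ) - ((m + 1 : ℕ) : ℝ) * g + z) ^ 2) =
        fun k : ℕ => ((k : ℝ) - m * g + (z - g)) ^ 2 := by
      funext k; push_cast; ring
    simp only [binomialMean]
    rw [e1, e2, ih, ih]
    push_cast; ring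

theorem binomialMean_pow_four (g : ℝ) (m : ℕ) (z : ℝ) :
    binomialMean g m (fun k => ((k : ℝ) - m * g + z) ^ 4) =
      z ^ 4 + 6 * z ^ 2 * (m * (g * (1 - g))) + 4 * z * (m * (g * (1 - g)) * (1 - 2 * g)) +
        (3 * m ^ 2 * (g * (1 - g)) ^ 2 + m * (g * (1 - g)) * (1 - 6 * (g * (1 - g)))) := by
  induction m generalizing z with
  | zero => simp [binomialMean]
  | succ m ih =>
    have e1 : (fun k : ℕ => (((k + 1 : ℕ) : ℝ) - ((m + 1 : ℕ) : ℝ) * g + z) ^ 4) =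
        fun k : ℕ => ((k : ℝ) - m * g + (z + 1 - g)) ^ 4 := by
      funext k; push_cast; ring
    have e2 : (fun k : ℕ => ((k : ℝ) - ((m + 1 : ℕ) : ℝ) * g + z) ^ 4) =
        fun k : ℕ => ((k : ℝ) - m * g + (z - g)) ^ 4 := by
      funext k; push_cast; ring
    simp only [binomialMean]
    rw [e1, e2, ih, ih]
    push_cast; ring

/-- Expansion of `w ↦ 1 / (κ + w)` to second order at the mean `d ^ 2 + s` of
`w = (X / m - 1 / 2) ^ 2`. The second summand comes from the bound `s * (4 * d ^ 2 + 2 * s)` for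
the variance of `w`. -/
theorem binomialMean_inv_le {g : ℝ} (h0 : 0 ≤ g) (h1 : g ≤ 1) {m : ℕ} (hm : 0 < m) {κ d s : ℝ}
    (hκ : 0 < κ) (hd : d = g - 1 / 2) (hs : s = g * (1 - g) / m) :
    binomialMean g m (fun k => 1 / (κ + ((k : ℝ) / m - 1 / 2) ^ 2)) ≤
      1 / (κ + (d ^ 2 + s)) + s * (4 * d ^ 2 + 2 * s) / (κ * (κ + (d ^ 2 + s)) ^ 2) := by
  have hm' : (0 : ℝ) < m := Nat.cast_pos.mpr hm
  have hm1 : (1 : ℝ) ≤ m := by exact_mod_cast hm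
  have hs0 : 0 ≤ s := by rw [hs]; exact div_nonneg (mul_nonneg h0 (by linarith)) hm'.le
  have hr : 0 < κ + (d ^ 2 + s) := by positivity
  set μ := d ^ 2 + s with hμ
  set r := κ + μ with hr_def
  -- the tangent-type bound for `1 / (κ + w)` at `w = μ`
  have key : ∀ w : ℝ, 0 ≤ w → 1 / (κ + w) ≤
      1 / r - (w - μ) / r ^ 2 + (w - μ) ^ 2 / (κ * r ^ 2) := by
    intro w hw
    have h2 : 1 / (κ + w) = 1 / r - (w - μ) / r ^ 2 + (w - μ) ^ 2 / ((κ + w) * r ^ 2) := by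
      have : κ + w ≠ 0 := by positivity
      field_simp
      rw [hr_def]; ring
    rw [h2]
    gcongr
    linarith
  have e : ∀ k : ℕ, ((k : ℝ) / m - 1 / 2) ^ 2 = ((k : ℝ) - m * g + m * d) ^ 2 / m ^ 2 := by
    intro k; rw [hd]; field_simp; ring
  have b1 : ∀ k : ℕ, 1 / (κ + ((k : ℝ) / m - 1 / 2) ^ 2) ≤
      (1 / r + μ / r ^ 2 + μ ^ 2 / (κ * r ^ 2)) +
      (-(1 / r ^ 2) - 2 * μ / (κ * r ^ 2)) / m ^ 2 * ((k : ℝ) - m * g + m * d) ^ 2 +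
      1 / (κ * r ^ 2) / m ^ 4 * ((k : ℝ) - m * g + m * d) ^ 4 := by
    intro k
    refine (key _ (sq_nonneg _)).trans (le_of_eq ?_)
    rw [e k]
    field_simp
    ring
  refine (binomialMean_mono h0 h1 m b1).trans ?_
  rw [binomialMean_linear, binomialMean_sq, binomialMean_pow_four]
  have hpq : g * (1 - g) = m * s := by rw [hs]; field_simp
  have hg : 1 - 2 * g = - (2 * d) := by rw [hd]; ring
  have hd2 : m * s = 1 / 4 - d ^ 2 := by rw [← hpq, hd]; ring
  rw [hpq, hg]
  have e3 : (1 / r + μ / r ^ 2 + μ ^ 2 / (κ * r ^ 2)) +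
      (-(1 / r ^ 2) - 2 * μ / (κ * r ^ 2)) / m ^ 2 * ((m * d) ^ 2 + m * (m * s)) +
      1 / (κ * r ^ 2) / m ^ 4 * ((m * d) ^ 4 + 6 * (m * d) ^ 2 * (m * (m * s)) +
        4 * (m * d) * (m * (m * s) * -(2 * d)) +
        (3 * m ^ 2 * (m * s) ^ 2 + m * (m * s) * (1 - 6 * (m * s)))) =
      1 / r + (4 * d ^ 2 * s - 8 * d ^ 2 * s / m + 2 * s ^ 2 + s * (1 - 6 * (m * s)) / m ^ 2) /
        (κ * r ^ 2) := by
    rw [hμ]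
    field_simp
    ring
  rw [e3]
  gcongr
  have : s * (1 - 6 * (m * s)) / m ^ 2 ≤ 8 * d ^ 2 * s / m := by
    rw [hd2, div_le_div_iff₀ (by positivity) hm']
    have h3 : 1 - 6 * (1 / 4 - d ^ 2) ≤ 8 * d ^ 2 := by nlinarith [sq_nonneg d]
    have h4 : s * (1 - 6 * (1 / 4 - d ^ 2)) * m ≤ s * (8 * d ^ 2) * m := by gcongr
    have h5 : s * (8 * d ^ 2) * m ≤ s * (8 * d ^ 2) * m ^ 2 := by
      apply mul_le_mul_of_nonneg_left _ (by positivity)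
      nlinarith
    linarith
  linarith

/-- The potential of a two-coloured state in which the fraction of one colour deviates by `δ` from
`1 / 2`. It vanishes exactly for unanimous states, and the cut-off `κ` bounds it by `1 / κ` for
balanced ones. -/
noncomputable def potential (κ δ : ℝ) : ℝ := (1 - 4 * δ ^ 2) / (κ + δ ^ 2)

/-- The potential is an affine function of `1 / (κ + δ ^ 2)`, so only the expectation of the latter
has to be estimated. -/
theorem potential_eq {κ : ℝ} (hκ : 0 < κ) (δ : ℝ) :
    potential κ δ = (1 + 4 * κ) * (1 / (κ + δ ^ 2)) - 4 := by
  have : κ + δ ^ 2 ≠ 0 := by positivity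
  unfold potential; field_simp; ring

/-- The polynomial inequality behind the contraction of the potential. Here `d` is the deviation
of `3 p ^ 2 - 2 p ^ 3` from `1 / 2` for `p = 1 / 2 + δ`, and `s` is the variance of the sampled
fraction. For `4 * δ ^ 2 ≤ 1 / 2` the gain comes from `d ^ 2 ≥ 3 / 2 * δ ^ 2` and, near `δ = 0`,
from the noise `s`; otherwise it comes from the factor `1 - c`. -/
theorem potential_step_aux {κ δ d s c : ℝ} (hκ : 0 < κ) (hκ1 : κ ≤ 1 / 4) (hc : c = 4 * δ ^ 2)
    (hc1 : c ≤ 1) (hd : d = δ * (3 / 2 - 2 * δ ^ 2))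
    (hs0 : (1 - 4 * d ^ 2) * κ / 400 ≤ s) (hs1 : 0 ≤ s) :
    (1 - c) * (1 - c / 4) * (κ + δ ^ 2) *
        (κ + d ^ 2 + s + (1 + 4 * κ) / 100 * (4 * d ^ 2 + 2 * s)) ≤
      (1 - 1 / 4000) * (κ + (d ^ 2 + s)) ^ 2 := by
  have hc0 : 0 ≤ c := by rw [hc]; positivity
  have hd2 : d ^ 2 = δ ^ 2 * ((3 - c) ^ 2 / 4) := by rw [hd, hc]; ring
  have hδ : 0 ≤ δ ^ 2 := sq_nonneg _
  set D := d ^ 2 with hD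
  set w := δ ^ 2 with hw
  have hD0 : 0 ≤ D := sq_nonneg _
  have hth : κ + D + s + (1 + 4 * κ) / 100 * (4 * D + 2 * s) ≤ κ + 1.08 * D + 1.04 * s := by
    nlinarith
  have hA : 0 ≤ (1 - c) * (1 - c / 4) := mul_nonneg (by linarith) (by linarith)
  refine (mul_le_mul_of_nonneg_left hth (by positivity)).trans ?_
  by_cases h : c ≤ 1 / 2
  · have hwD : w ≤ 2 / 3 * D := by
      rw [hd2]; nlinarith [mul_nonneg hδ (by nlinarith : 0 ≤ (3 - c) ^ 2 / 4 - 25 / 16)]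
    have hs2 : κ / 2000 ≤ s := by
      refine le_trans ?_ hs0
      have : 1 - 4 * D = (1 - c) ^ 2 * (1 - c / 4) := by
        rw [hd2, show w = c / 4 by rw [hc]; ring]; ring
      have : 0.2 ≤ 1 - 4 * D := by
        have h3 : 1 / 4 ≤ (1 - c) ^ 2 := by nlinarith
        have h4 : 1 / 4 * (7 / 8) ≤ (1 - c) ^ 2 * (1 - c / 4) := by gcongr; linarith
        rw [this]; norm_num at h4 ⊢; linarith
      nlinarith
    have h1 : (1 - c) * (1 - c / 4) ≤ 1 := by nlinarith
    have h2 : (1 - c) * (1 - c / 4) * (κ + w) ≤ κ + 2 / 3 * D := by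
      calc (1 - c) * (1 - c / 4) * (κ + w) ≤ 1 * (κ + w) := by gcongr
        _ ≤ _ := by linarith
    refine (mul_le_mul_of_nonneg_right h2 (by positivity)).trans ?_
    nlinarith [mul_nonneg hκ.le hD0, mul_nonneg hκ.le hs1, mul_nonneg hD0 hs1, sq_nonneg D,
      sq_nonneg s, mul_le_mul_of_nonneg_left hs2 hκ.le]
  · push Not at h
    have hwD : w ≤ D := by
      rw [hd2]; nlinarith [mul_nonneg hδ (by nlinarith : 0 ≤ (3 - c) ^ 2 / 4 - 1)]
    have h1 : (1 - c) * (1 - c / 4) ≤ 1 / 2 := by nlinarith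
    have h2 : (1 - c) * (1 - c / 4) * (κ + w) ≤ 1 / 2 * (κ + D) := by gcongr
    refine (mul_le_mul_of_nonneg_right h2 (by positivity)).trans ?_
    nlinarith [mul_nonneg hκ.le hD0, mul_nonneg hκ.le hs1, mul_nonneg hD0 hs1, sq_nonneg D,
      sq_nonneg s, sq_nonneg κ]

/-- Let each of `m` servers independently take the majority of three samples from a population with
a fraction `p` of one colour. Then the potential of the new population is on average smaller than
that of the old one by a constant factor. The cut-off `100 / n` is a large multiple of the sampling
variance, so that the second-order error is dominated by the drift. -/
theorem binomialMean_potential_le {n m : ℕ} (hn : 400 ≤ n) (hm : (n : ℝ) / 4 ≤ m) (hmn : m ≤ n)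
    {p : ℝ} (hp0 : 0 ≤ p) (hp1 : p ≤ 1) :
    binomialMean (3 * p ^ 2 - 2 * p ^ 3) m (fun k => potential (100 / n) ((k : ℝ) / m - 1 / 2)) ≤
      (1 - 1 / 4000) * potential (100 / n) (p - 1 / 2) := by
  have hn' : (400 : ℝ) ≤ n := by exact_mod_cast hn
  have hmn' : (m : ℝ) ≤ n := by exact_mod_cast hmn
  have hm' : (0 : ℝ) < m := by linarith
  obtain ⟨κ, hκd⟩ : ∃ κ : ℝ, κ = 100 / n := ⟨_, rfl⟩
  rw [← hκd]
  have hκ : 0 < κ := by rw [hκd]; positivity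
  have hκ1 : κ ≤ 1 / 4 := by rw [hκd, div_le_div_iff₀ (by linarith) (by norm_num)]; linarith
  have h0 : 0 ≤ 3 * p ^ 2 - 2 * p ^ 3 := by
    nlinarith [mul_nonneg (sq_nonneg p) (by linarith : 0 ≤ 3 - 2 * p)]
  have h1 : 3 * p ^ 2 - 2 * p ^ 3 ≤ 1 := by
    nlinarith [mul_nonneg (sq_nonneg (1 - p)) (by linarith : 0 ≤ 1 + 2 * p)]
  set g := 3 * p ^ 2 - 2 * p ^ 3 with hg
  obtain ⟨d, hd⟩ : ∃ d, d = g - 1 / 2 := ⟨_, rfl⟩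
  obtain ⟨s, hs⟩ : ∃ s, s = g * (1 - g) / m := ⟨_, rfl⟩
  obtain ⟨δ, hδ⟩ : ∃ δ, δ = p - 1 / 2 := ⟨_, rfl⟩
  obtain ⟨c, hc⟩ : ∃ c, c = 4 * δ ^ 2 := ⟨_, rfl⟩
  have hc1 : c ≤ 1 := by rw [hc, hδ]; nlinarith
  have hdδ : d = δ * (3 / 2 - 2 * δ ^ 2) := by rw [hd, hδ, hg]; ring
  have he : 1 - 4 * d ^ 2 = 4 * (g * (1 - g)) := by rw [hd]; ring
  have hgg : 0 ≤ g * (1 - g) := mul_nonneg h0 (by linarith)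
  have hs1 : 0 ≤ s := by rw [hs]; positivity
  have hs0 : (1 - 4 * d ^ 2) * κ / 400 ≤ s := by
    rw [he, hs, hκd, show 4 * (g * (1 - g)) * (100 / (n : ℝ)) / 400 = g * (1 - g) / n by
      field_simp; ring]
    gcongr
  have aux := potential_step_aux hκ hκ1 hc hc1 hdδ hs0 hs1
  have inv := binomialMean_inv_le h0 h1 (by exact_mod_cast hm' : 0 < m) hκ hd hs
  have lin : binomialMean g m (fun k => potential κ ((k : ℝ) / m - 1 / 2)) =
      -4 + (1 + 4 * κ) * binomialMean g m (fun k => 1 / (κ + ((k : ℝ) / m - 1 / 2) ^ 2)) := by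
    have := binomialMean_linear g m (-4) (1 + 4 * κ) 0
      (fun k => 1 / (κ + ((k : ℝ) / m - 1 / 2) ^ 2)) (fun _ => 0)
    simp only [zero_mul, add_zero] at this
    rw [← this]
    congr 1; funext k; rw [potential_eq hκ]; ring
  rw [lin, ← hδ]
  have hr : 0 < κ + (d ^ 2 + s) := by positivity
  have hr2 : 0 < κ + δ ^ 2 := by positivity
  set r := κ + (d ^ 2 + s) with hrd
  have hfac : 1 - 4 * d ^ 2 = (1 - c) * ((1 - c) * (1 - c / 4)) := by
    rw [hdδ, hc]; ring
  have hsκ : s ≤ (1 - 4 * d ^ 2) * κ / 100 := by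
    rw [he, hs, hκd, show 4 * (g * (1 - g)) * (100 / (n : ℝ)) / 100 = g * (1 - g) / (n / 4) by
      field_simp]
    gcongr
  calc -4 + (1 + 4 * κ) * binomialMean g m (fun k => 1 / (κ + ((k : ℝ) / m - 1 / 2) ^ 2))
      ≤ -4 + (1 + 4 * κ) * (1 / r + s * (4 * d ^ 2 + 2 * s) / (κ * r ^ 2)) := by gcongr
    _ = (1 - 4 * (d ^ 2 + s)) / r + (1 + 4 * κ) * s * (4 * d ^ 2 + 2 * s) / (κ * r ^ 2) := by
      field_simp; rw [hrd]; ring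
    _ ≤ (1 - 4 * d ^ 2) / r +
        (1 + 4 * κ) * ((1 - 4 * d ^ 2) * κ / 100) * (4 * d ^ 2 + 2 * s) / (κ * r ^ 2) := by
      gcongr; linarith
    _ = (1 - c) * ((1 - c) * (1 - c / 4) *
        (κ + d ^ 2 + s + (1 + 4 * κ) / 100 * (4 * d ^ 2 + 2 * s))) / r ^ 2 := by
      rw [hfac]; field_simp; rw [hrd]; ring
    _ ≤ (1 - 1 / 4000) * potential κ δ := by
      unfold potential
      rw [← hc, ← mul_div_assoc, div_le_div_iff₀ (by positivity) hr2]
      have := mul_le_mul_of_nonneg_left aux (by linarith : 0 ≤ 1 - c)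
      nlinarith [this]

/-! ### The median rule at a single server -/

theorem card_filterMap_of_isSome {K : Type*} {k : ℕ} (L : Finset (Fin k)) (ρ : Fin k → Option K)
    (h : ∀ j ∈ L, (ρ j).isSome) : (L.val.filterMap ρ).card = L.card := by
  have : L.val.filterMap ρ = L.val.attach.map fun j => (ρ j.1).get (h j.1 j.2) := by
    conv_lhs => rw [← Multiset.attach_map_val L.val]
    rw [Multiset.filterMap_map, ← Multiset.filterMap_eq_map]
    congr 1
    funext j
    simp
  rw [this, Multiset.card_map, Multiset.card_attach, Finset.card_def]

section Median

variable {K : Type*} [LinearOrder K]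

theorem mem_of_median_eq_some {s : Multiset K} {y : K} (h : median s = some y) : y ∈ s :=
  (Multiset.mem_sort (· ≤ ·)).1 (List.mem_of_getElem? h)

theorem median_isSome {s : Multiset K} (hs : 0 < s.card) : (median s).isSome := by
  unfold median
  rw [List.getElem?_eq_getElem (by rw [Multiset.length_sort]; omega)]
  rfl

theorem median_le_iff {s : Multiset K} (hs : s.card = 3) (v : K) :
    (∃ y ∈ median s, y ≤ v) ↔ 2 ≤ s.countP (· ≤ v) := by
  have hp := Multiset.pairwise_sort s (· ≤ ·)
  have hl : (s.sort (· ≤ ·)).length = 3 := by rw [Multiset.length_sort, hs]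
  have hc : s.countP (· ≤ v) = (s.sort (· ≤ ·)).countP (· ≤ v) := by
    conv_lhs => rw [← Multiset.sort_eq s (· ≤ ·)]
    rw [Multiset.coe_countP]
  obtain ⟨a, b, c, habc⟩ := List.length_eq_three.1 hl
  rw [hc]
  unfold median
  rw [hs, habc]
  rw [habc] at hp
  simp only [List.pairwise_cons, List.mem_cons, List.not_mem_nil, or_false] at hp
  have hab : a ≤ b := hp.1 b (Or.inl rfl)
  have hbc : b ≤ c := hp.2.1 c rfl
  simp only [List.countP_cons, List.countP_nil]
  by_cases hb : b ≤ v
  · simp [hb, hab.trans hb]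
  · have : ¬ c ≤ v := fun h => hb (hbc.trans h)
    simp [hb, this]
    split_ifs <;> omega

variable {n k ℓ : ℕ}

theorem card_selected {K : Type*} {n k ℓ : ℕ} (c : Choice n k ℓ) (ρ : Fin k → Option K)
    (h : ℓ ≤ (Finset.univ.filter fun j => (ρ j).isSome).card) :
    ((c.2 ⟨_, h⟩).1.val.filterMap ρ).card = ℓ := by
  have hL := (c.2 ⟨_, h⟩).2
  exact (card_filterMap_of_isSome _ ρ fun j hj => (Finset.mem_filter.1 (hL.1 hj)).2).trans hL.2

theorem countP_selected (L : Finset (Fin k)) (ρ : Fin k → Option K) (v : K) :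
    (L.val.filterMap ρ).countP (· ≤ v) = (L.filter fun j => ∃ y ∈ ρ j, y ≤ v).card := by
  rw [Multiset.countP_eq_card_filter, Multiset.filter_filterMap]
  rw [Finset.card_def, Finset.filter_val]
  induction L.val using Multiset.induction with
  | empty => simp
  | cons a s ih =>
    rw [Multiset.filter_cons, Multiset.card_add, ← ih]
    rcases h : ρ a with _ | y
    · rw [Multiset.filterMap_cons_none] <;> simp [h]
    · by_cases hy : y ≤ v
      · rw [Multiset.filterMap_cons_some _ _ _ (b := y) (by simp [h, hy])]
        simp [hy, add_comm]
      · rw [Multiset.filterMap_cons_none] <;> simp [h, not_le.1 hy]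

theorem newValue_isSome_iff (hℓ : 0 < ℓ) (c : Choice n k ℓ) (ρ : Fin k → Option K) :
    (newValue c ρ).isSome ↔ ℓ ≤ (Finset.univ.filter fun j => (ρ j).isSome).card := by
  unfold newValue
  split_ifs with h
  · simp only [h, iff_true]
    exact median_isSome (by rw [card_selected]; exact hℓ)
  · simp [h]

theorem newValue_le_iff (c : Choice n k 3) (ρ : Fin k → Option K) (v : K) :
    (∃ y ∈ newValue c ρ, y ≤ v) ↔
      ∃ h : 3 ≤ (Finset.univ.filter fun j => (ρ j).isSome).card,
        2 ≤ ((c.2 ⟨_, h⟩).1.filter fun j => ∃ y ∈ ρ j, y ≤ v).card := by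
  by_cases h : 3 ≤ (Finset.univ.filter fun j => (ρ j).isSome).card
  · simp only [h, exists_true_left]
    rw [← countP_selected, ← median_le_iff (card_selected c ρ h)]
    unfold newValue
    rw [dif_pos h]
  · unfold newValue
    simp [h]

theorem exists_reply_eq_newValue {c : Choice n k ℓ} {ρ : Fin k → Option K} {y : K}
    (h : newValue c ρ = some y) : ∃ j, ρ j = some y := by
  unfold newValue at h
  split_ifs at h with h1
  obtain ⟨j, -, hj⟩ := (Multiset.mem_filterMap _ _).1 (mem_of_median_eq_some h)
  exact ⟨j, hj⟩

end Median

/-! ### Counting the choices of one round -/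

section Counting

/-- Among the targets whose set of answered requests is `A`, those at the positions of `M ⊆ A` are
independent and uniform on the useful servers `U`; so they all lie in `O ⊆ U` for a
`(#O / #U) ^ #M`-fraction of them. -/
theorem card_targets_mul {n k : ℕ} {U O : Finset (Fin n)} (hOU : O ⊆ U) {A M : Finset (Fin k)}
    (hM : M ⊆ A) :
    (Finset.univ.filter fun τ : Fin k → Fin n =>
        (Finset.univ.filter fun j => τ j ∈ U) = A ∧ ∀ j ∈ M, τ j ∈ O).card * U.card ^ M.card =
      O.card ^ M.card * (Finset.univ.filter fun τ : Fin k → Fin n =>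
        (Finset.univ.filter fun j => τ j ∈ U) = A).card := by
  have key : ∀ M : Finset (Fin k), M ⊆ A → (Finset.univ.filter fun τ : Fin k → Fin n =>
        (Finset.univ.filter fun j => τ j ∈ U) = A ∧ ∀ j ∈ M, τ j ∈ O) =
      Fintype.piFinset fun j => if j ∈ M then O else if j ∈ A then U else Uᶜ := by
    intro M hM
    ext τ
    simp only [Finset.mem_filter, Finset.mem_univ, true_and, Fintype.mem_piFinset,
      Finset.ext_iff]
    constructor
    · rintro ⟨h1, h2⟩ j
      split_ifs with hjM hjA
      · exact h2 j hjM
      · exact (h1 j).2 hjA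
      · rw [Finset.mem_compl, h1 j]; exact hjA
    · intro h
      refine ⟨fun j => ?_, fun j hj => by simpa [hj] using h j⟩
      have hj := h j
      split_ifs at hj with hjM hjA
      · exact ⟨fun _ => hM hjM, fun _ => hOU hj⟩
      · exact ⟨fun _ => hjA, fun _ => hj⟩
      · exact ⟨fun h => absurd h (Finset.mem_compl.1 hj), fun h => absurd h hjA⟩
  have key0 := key ∅ (Finset.empty_subset _)
  simp only [Finset.notMem_empty, false_imp_iff, implies_true, and_true, if_false] at key0
  rw [key M hM, key0, Fintype.card_piFinset, Fintype.card_piFinset]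
  have hprod : ∀ r : ℕ, (∏ j : Fin k, if j ∈ M then r else 1) = r ^ M.card := by
    intro r
    rw [Finset.prod_ite_mem, Finset.univ_inter, Finset.prod_const]
  rw [← hprod, ← hprod, ← Finset.prod_mul_distrib, ← Finset.prod_mul_distrib]
  refine Finset.prod_congr rfl fun j _ => ?_
  by_cases hj : j ∈ M
  · simp [hj, hM hj]
  · simp [hj]

theorem card_targets_majority {n k : ℕ} {U O : Finset (Fin n)} (hOU : O ⊆ U)
    {A L : Finset (Fin k)} (hLA : L ⊆ A) (hL : L.card = 3) :
    ((Finset.univ.filter fun τ : Fin k → Fin n =>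
        (Finset.univ.filter fun j => τ j ∈ U) = A ∧ 2 ≤ (L.filter fun j => τ j ∈ O).card).card : ℝ)
        * U.card ^ 3 =
      (3 * O.card ^ 2 * U.card - 2 * O.card ^ 3) * (Finset.univ.filter fun τ : Fin k → Fin n =>
        (Finset.univ.filter fun j => τ j ∈ U) = A).card := by
  -- the majority of three bits is `ab + ac + bc - 2abc`
  obtain ⟨a, b, c, hab, hac, hbc, rfl⟩ := Finset.card_eq_three.1 hL
  have hMs : ∀ M : Finset (Fin k), M ⊆ {a, b, c} →
      ((Finset.univ.filter fun τ : Fin k → Fin n =>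
        (Finset.univ.filter fun j => τ j ∈ U) = A ∧ ∀ j ∈ M, τ j ∈ O).card : ℝ) *
          U.card ^ M.card =
      O.card ^ M.card * (Finset.univ.filter fun τ : Fin k → Fin n =>
        (Finset.univ.filter fun j => τ j ∈ U) = A).card := fun M hM => by
    exact_mod_cast card_targets_mul hOU (hM.trans hLA)
  have m1 := hMs {a, b} (by simp [Finset.insert_subset_iff])
  have m2 := hMs {a, c} (by simp [Finset.insert_subset_iff])
  have m3 := hMs {b, c} (by simp)
  have m4 := hMs {a, b, c} subset_rfl
  rw [Finset.card_pair (by assumption)] at m1 m2 m3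
  rw [hL] at m4
  have incl : ((Finset.univ.filter fun τ : Fin k → Fin n =>
        (Finset.univ.filter fun j => τ j ∈ U) = A ∧
          2 ≤ (({a, b, c} : Finset (Fin k)).filter fun j => τ j ∈ O).card).card : ℝ) =
      (Finset.univ.filter fun τ : Fin k → Fin n =>
        (Finset.univ.filter fun j => τ j ∈ U) = A ∧ ∀ j ∈ ({a, b} : Finset _), τ j ∈ O).card +
      (Finset.univ.filter fun τ : Fin k → Fin n =>
        (Finset.univ.filter fun j => τ j ∈ U) = A ∧ ∀ j ∈ ({a, c} : Finset _), τ j ∈ O).card +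
      (Finset.univ.filter fun τ : Fin k → Fin n =>
        (Finset.univ.filter fun j => τ j ∈ U) = A ∧ ∀ j ∈ ({b, c} : Finset _), τ j ∈ O).card -
      2 * (Finset.univ.filter fun τ : Fin k → Fin n =>
        (Finset.univ.filter fun j => τ j ∈ U) = A ∧
          ∀ j ∈ ({a, b, c} : Finset _), τ j ∈ O).card := by
    simp only [Finset.card_filter, Nat.cast_sum, Finset.mul_sum]
    rw [← Finset.sum_add_distrib, ← Finset.sum_add_distrib, ← Finset.sum_sub_distrib]
    refine Finset.sum_congr rfl fun τ _ => ?_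
    rw [Finset.sum_insert (by simp [hab, hac]), Finset.sum_insert (by simp [hbc]),
      Finset.sum_singleton]
    by_cases h : (Finset.univ.filter fun j => τ j ∈ U) = A
    · by_cases h1 : τ a ∈ O <;> by_cases h2 : τ b ∈ O <;> by_cases h3 : τ c ∈ O <;>
        (simp [h, h1, h2, h3]; try norm_num)
    · simp [h]
  rw [incl]
  linear_combination (U.card : ℝ) * (m1 + m2 + m3) - 2 * m4

/-- Conditioned on at least three replies, a majority of the three used replies comes from `O` with
probability `3 p ^ 2 - 2 p ^ 3`, where `p = #O / #U`; here with denominators cleared. -/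
theorem card_choice_majority {n k : ℕ} {U O : Finset (Fin n)} (hOU : O ⊆ U) :
    ((Finset.univ.filter fun c : Choice n k 3 =>
        ∃ h : 3 ≤ (Finset.univ.filter fun j => c.1 j ∈ U).card,
          2 ≤ ((c.2 ⟨_, h⟩).1.filter fun j => c.1 j ∈ O).card).card : ℝ) * U.card ^ 3 =
      (3 * O.card ^ 2 * U.card - 2 * O.card ^ 3) * (Finset.univ.filter fun c : Choice n k 3 =>
        3 ≤ (Finset.univ.filter fun j => c.1 j ∈ U).card).card := by
  have hsum : ∀ F : Choice n k 3 → ℝ, ∑ c, F c =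
      ∑ σ : (A : {A : Finset (Fin k) // 3 ≤ A.card}) →
          {L : Finset (Fin k) // L ⊆ A.1 ∧ L.card = 3},
        ∑ A : Finset (Fin k), ∑ τ : Fin k → Fin n,
          if (Finset.univ.filter fun j => τ j ∈ U) = A then F (τ, σ) else 0 := by
    intro F
    refine (Fintype.sum_prod_type_right (fun p : (Fin k → Fin n) ×
      ((A : {A : Finset (Fin k) // 3 ≤ A.card}) →
          {L : Finset (Fin k) // L ⊆ A.1 ∧ L.card = 3}) => F p)).trans ?_
    refine Finset.sum_congr rfl fun σ _ => ?_
    rw [Finset.sum_comm]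
    simp
  simp only [Finset.card_filter, Nat.cast_sum]
  rw [hsum, hsum, Finset.sum_mul, Finset.mul_sum]
  refine Finset.sum_congr rfl fun σ _ => ?_
  rw [Finset.sum_mul, Finset.mul_sum]
  refine Finset.sum_congr rfl fun A _ => ?_
  by_cases hA : 3 ≤ A.card
  · have key := card_targets_majority (A := A) hOU (σ ⟨A, hA⟩).2.1 (σ ⟨A, hA⟩).2.2
    simp only [Finset.card_filter, Nat.cast_sum] at key
    convert key using 2
    · refine Finset.sum_congr rfl fun τ _ => ?_
      by_cases h : (Finset.univ.filter fun j => τ j ∈ U) = A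
      · subst h
        simp [hA]
      · simp [h]
    · refine Finset.sum_congr rfl fun τ _ => ?_
      by_cases h : (Finset.univ.filter fun j => τ j ∈ U) = A
      · subst h
        simp [hA]
      · simp [h]
  · have e1 : ∀ τ : Fin k → Fin n, (Finset.univ.filter fun j => τ j ∈ U) = A →
        ¬ 3 ≤ (Finset.univ.filter fun j => τ j ∈ U).card := by
      rintro τ rfl; exact hA
    rw [Finset.sum_eq_zero, Finset.sum_eq_zero]
    · simp
    · intro τ _
      by_cases h : (Finset.univ.filter fun j => τ j ∈ U) = A
      · simp [e1 τ h]
      · simp [h]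
    · intro τ _
      by_cases h : (Finset.univ.filter fun j => τ j ∈ U) = A
      · simp [e1 τ h]
      · simp [h]

/-- If each of `n` independent choices that satisfies `P` satisfies the stronger `Q` with
conditional probability `g`, then the number of `Q`s is binomial given the number of `P`s. -/
theorem sum_binomialMean {C : Type*} [Fintype C] (g : ℝ) {n : ℕ} (P Q : Fin n → C → Prop)
    [∀ i c, Decidable (P i c)] [∀ i c, Decidable (Q i c)] (hQP : ∀ i c, Q i c → P i c)
    (hg : ∀ i, ((Finset.univ.filter (Q i)).card : ℝ) = g * (Finset.univ.filter (P i)).card)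
    (F : ℕ → ℕ → ℝ) :
    ∑ a : Fin n → C, F (Finset.univ.filter fun i => P i (a i)).card
        (Finset.univ.filter fun i => Q i (a i)).card =
      ∑ a : Fin n → C, binomialMean g (Finset.univ.filter fun i => P i (a i)).card
        (F (Finset.univ.filter fun i => P i (a i)).card) := by
  induction n generalizing F with
  | zero => simp [binomialMean]
  | succ n ih =>
    have hcard : ∀ (R : Fin (n + 1) → C → Prop) [∀ i c, Decidable (R i c)] (c : C) (a : Fin n → C),
        (Finset.univ.filter fun i => R i ((Fin.cons c a : Fin (n + 1) → C) i)).card =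
          (Finset.univ.filter fun i : Fin n => R i.succ (a i)).card + if R 0 c then 1 else 0 := by
      intro R _ c a
      rw [Finset.card_filter, Fin.sum_univ_succ, Finset.card_filter, add_comm]
      simp
    have hsplit : ∀ G : (Fin (n + 1) → C) → ℝ,
        ∑ a, G a = ∑ c : C, ∑ a : Fin n → C, G (Fin.cons c a) := by
      intro G
      rw [← (Fin.consEquiv (fun _ => C)).sum_comp, Fintype.sum_prod_type]
      rfl
    rw [hsplit, hsplit]
    simp only [hcard]
    have step : ∀ c : C, _ := fun c => ih (fun i => P i.succ) (fun i => Q i.succ)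
      (fun i => hQP i.succ) (fun i => hg i.succ)
      (fun m k => F (m + if P 0 c then 1 else 0) (k + if Q 0 c then 1 else 0))
    simp only [step]
    rw [Finset.sum_comm, Finset.sum_comm (s := (Finset.univ : Finset C))]
    refine Finset.sum_congr rfl fun a _ => ?_
    generalize (Finset.univ.filter fun i : Fin n => P i.succ (a i)).card = m
    -- both sides are combinations of the numbers of `c` with `Q 0 c`, `P 0 c` and `¬ P 0 c`
    have e1 : ∀ c : C, binomialMean g m (fun k =>
          F (m + if P 0 c then 1 else 0) (k + if Q 0 c then 1 else 0)) =
        (if Q 0 c then 1 else 0) *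
          (binomialMean g m (fun k => F (m + 1) (k + 1)) - binomialMean g m (F (m + 1))) +
        (if P 0 c then 1 else 0) * (binomialMean g m (F (m + 1)) - binomialMean g m (F m)) +
        binomialMean g m (F m) := by
      intro c
      by_cases hP : P 0 c
      · by_cases hQ : Q 0 c
        · simp [hP, hQ]
        · simp [hP, hQ]
      · have hQ : ¬ Q 0 c := fun h => hP (hQP 0 c h)
        simp [hP, hQ]
    have e2 : ∀ c : C, binomialMean g (m + if P 0 c then 1 else 0)
          (F (m + if P 0 c then 1 else 0)) =
        (if P 0 c then 1 else 0) * (binomialMean g (m + 1) (F (m + 1)) - binomialMean g m (F m)) +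
        binomialMean g m (F m) := by
      intro c
      by_cases hP : P 0 c <;> simp [hP]
    simp only [e1, e2, Finset.sum_add_distrib, ← Finset.sum_mul]
    have h0 := hg 0
    simp only [Finset.card_filter, Nat.cast_sum, Nat.cast_ite, Nat.cast_one, Nat.cast_zero] at h0
    rw [h0]
    simp only [binomialMean]
    ring

end Counting

/-! ### One round of the protocol -/

section Round

variable {K : Type*} [LinearOrder K] {n k ℓ : ℕ}

/-- The states after a round that starts with the states `x`, in which `B` is blocked and the
servers make the choices `a`. -/
noncomputable def nextState (B : Finset (Fin n)) (x : Fin n → Option K)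
    (a : Fin n → Choice n k ℓ) : Fin n → Option K :=
  fun i => newValue (a i) fun j => reply B x i ((a i).1 j)

/-- The useful servers in a round that starts with the states `x` and in which `B` is blocked. -/
def active (B : Finset (Fin n)) (x : Fin n → Option K) : Finset (Fin n) :=
  Finset.univ.filter fun i => i ∉ B ∧ (x i).isSome

/-- The useful servers whose value is at most `v`. -/
def activeLE (v : K) (B : Finset (Fin n)) (x : Fin n → Option K) : Finset (Fin n) :=
  Finset.univ.filter fun i => i ∉ B ∧ ∃ y ∈ x i, y ≤ v

theorem isSome_of_exists_le {o : Option K} {v : K} (h : ∃ y ∈ o, y ≤ v) : o.isSome := by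
  obtain ⟨y, hy, -⟩ := h
  exact Option.isSome_iff_exists.2 ⟨y, hy⟩

theorem activeLE_subset (v : K) (B : Finset (Fin n)) (x : Fin n → Option K) :
    activeLE v B x ⊆ active B x := by
  intro i hi
  simp only [activeLE, active, Finset.mem_filter, Finset.mem_univ, true_and] at hi ⊢
  exact ⟨hi.1, isSome_of_exists_le hi.2⟩

theorem reply_of_notMem {K : Type*} {n : ℕ} {B : Finset (Fin n)} {i : Fin n} (hi : i ∉ B)
    (x : Fin n → Option K) (j : Fin n) : reply B x i j = if j ∈ B then none else x j := by
  simp [reply, hi]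

theorem reply_isSome_iff {K : Type*} {n : ℕ} {B : Finset (Fin n)} {i : Fin n} (hi : i ∉ B)
    (x : Fin n → Option K) (j : Fin n) : (reply B x i j).isSome ↔ j ∈ active B x := by
  rw [reply_of_notMem hi, active]
  by_cases hj : j ∈ B <;> simp [hj]

theorem reply_le_iff {B : Finset (Fin n)} {i : Fin n} (hi : i ∉ B) (x : Fin n → Option K)
    (v : K) (j : Fin n) : (∃ y ∈ reply B x i j, y ≤ v) ↔ j ∈ activeLE v B x := by
  rw [reply_of_notMem hi, activeLE]
  by_cases hj : j ∈ B <;> simp [hj]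

theorem newValue_reply_of_mem {B : Finset (Fin n)} {i : Fin n} (hi : i ∈ B) (hℓ : 0 < ℓ)
    (x : Fin n → Option K) (c : Choice n k ℓ) :
    newValue c (fun j => reply B x i (c.1 j)) = none := by
  refine Option.not_isSome_iff_eq_none.1 fun h => ?_
  have := (newValue_isSome_iff hℓ c _).1 h
  simp [reply, hi] at this
  omega

theorem newValue_reply_isSome_iff {B : Finset (Fin n)} {i : Fin n} (hi : i ∉ B) (hℓ : 0 < ℓ)
    (x : Fin n → Option K) (c : Choice n k ℓ) :
    (newValue c fun j => reply B x i (c.1 j)).isSome ↔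
      ℓ ≤ (Finset.univ.filter fun j => c.1 j ∈ active B x).card := by
  rw [newValue_isSome_iff hℓ]
  simp only [reply_isSome_iff hi]

theorem newValue_reply_le_iff {B : Finset (Fin n)} {i : Fin n} (hi : i ∉ B)
    (x : Fin n → Option K) (v : K) (c : Choice n k 3) :
    (∃ y ∈ newValue c fun j => reply B x i (c.1 j), y ≤ v) ↔
      ∃ h : 3 ≤ (Finset.univ.filter fun j => c.1 j ∈ active B x).card,
          2 ≤ ((c.2 ⟨_, h⟩).1.filter fun j => c.1 j ∈ activeLE v B x).card := by
  have e : (Finset.univ.filter fun j => (reply B x i (c.1 j)).isSome) =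
      Finset.univ.filter fun j => c.1 j ∈ active B x := by
    simp only [reply_isSome_iff hi]
  have congr_set : ∀ A A' : Finset (Fin k), A = A' →
      ((∃ h : 3 ≤ A.card, 2 ≤ ((c.2 ⟨A, h⟩).1.filter fun j => c.1 j ∈ activeLE v B x).card) ↔
        ∃ h : 3 ≤ A'.card, 2 ≤ ((c.2 ⟨A', h⟩).1.filter fun j => c.1 j ∈ activeLE v B x).card) := by
    rintro A _ rfl
    rfl
  rw [newValue_le_iff, ← congr_set _ _ e]
  simp only [reply_le_iff hi]

/-- Given that a server decides on a value, the value is at most `v` with probability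
`3 p ^ 2 - 2 p ^ 3`, where `p` is the fraction of the useful servers with a value at most `v`. -/
theorem card_newValue_le (v : K) {B : Finset (Fin n)} {x : Fin n → Option K}
    (hU : 0 < (active B x).card) (i : Fin n) {p : ℝ}
    (hp : p = ((activeLE v B x).card : ℝ) / (active B x).card) :
    ((Finset.univ.filter fun c : Choice n k 3 =>
        ∃ y ∈ newValue c fun j => reply B x i (c.1 j), y ≤ v).card : ℝ) =
      (3 * p ^ 2 - 2 * p ^ 3) * (Finset.univ.filter fun c : Choice n k 3 =>
        (newValue c fun j => reply B x i (c.1 j)).isSome).card := by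
  by_cases hi : i ∈ B
  · simp [newValue_reply_of_mem hi]
  · simp only [newValue_reply_isSome_iff hi (show 0 < 3 by norm_num), newValue_reply_le_iff hi]
    have := card_choice_majority (k := k) (activeLE_subset v B x)
    have hU' : ((active B x).card : ℝ) ≠ 0 := by positivity
    rw [hp]
    field_simp
    linear_combination this

/-- The potential of the two-colouring of the useful servers by the threshold `v`, set to `0` when
less than a quarter of the servers is useful. -/
noncomputable def thresholdPotential (v : K) (B : Finset (Fin n)) (x : Fin n → Option K) : ℝ :=
  if (n : ℝ) / 4 ≤ (active B x).card then
    potential (100 / n) ((activeLE v B x).card / (active B x).card - 1 / 2) else 0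

theorem fraction_mem (v : K) (B : Finset (Fin n)) (x : Fin n → Option K) :
    0 ≤ ((activeLE v B x).card : ℝ) / (active B x).card ∧
      ((activeLE v B x).card : ℝ) / (active B x).card ≤ 1 :=
  ⟨by positivity, div_le_one_of_le₀
    (by exact_mod_cast Finset.card_le_card (activeLE_subset v B x)) (by positivity)⟩

theorem potential_nonneg {κ p : ℝ} (hκ : 0 ≤ κ) (h0 : 0 ≤ p) (h1 : p ≤ 1) :
    0 ≤ potential κ (p - 1 / 2) :=
  div_nonneg (by nlinarith) (by positivity)

theorem thresholdPotential_nonneg (v : K) (B : Finset (Fin n)) (x : Fin n → Option K) :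
    0 ≤ thresholdPotential v B x := by
  unfold thresholdPotential
  split_ifs
  · exact potential_nonneg (by positivity) (fraction_mem v B x).1 (fraction_mem v B x).2
  · exact le_rfl

/-- One round contracts the potential on average, whatever sets `B` and `B'` are blocked in this
round and the next one, as long as they do not depend on the choices of this round. -/
theorem sum_thresholdPotential_le (hn : 400 ≤ n) (v : K) (B B' : Finset (Fin n))
    (x : Fin n → Option K) (hU : (n : ℝ) / 4 ≤ (active B x).card) :
    ∑ a : Fin n → Choice n k 3, thresholdPotential v B' (nextState B x a) ≤
      (1 - 1 / 4000) * thresholdPotential v B x * Fintype.card (Fin n → Choice n k 3) := by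
  have hn' : (400 : ℝ) ≤ n := by exact_mod_cast hn
  have hU0 : 0 < (active B x).card := by
    have : (0 : ℝ) < (active B x).card := by linarith
    exact_mod_cast this
  obtain ⟨p, hp⟩ : ∃ p, p = ((activeLE v B x).card : ℝ) / (active B x).card := ⟨_, rfl⟩
  have hp01 := fraction_mem v B x
  rw [← hp] at hp01
  classical
  let F : ℕ → ℕ → ℝ := fun m j =>
    if (n : ℝ) / 4 ≤ m then potential (100 / n) ((j : ℝ) / m - 1 / 2) else 0
  have key := sum_binomialMean (C := Choice n k 3) (3 * p ^ 2 - 2 * p ^ 3)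
    (fun i c => i ∉ B' ∧ (newValue c fun j => reply B x i (c.1 j)).isSome)
    (fun i c => i ∉ B' ∧ ∃ y ∈ newValue c fun j => reply B x i (c.1 j), y ≤ v)
    (fun i c h => ⟨h.1, isSome_of_exists_le h.2⟩)
    (fun i => by
      by_cases hi : i ∈ B'
      · simp [hi]
      · simpa only [hi, not_false_eq_true, true_and] using card_newValue_le v hU0 i hp) F
  have hlhs : ∑ a : Fin n → Choice n k 3, thresholdPotential v B' (nextState B x a) =
      ∑ a : Fin n → Choice n k 3, binomialMean (3 * p ^ 2 - 2 * p ^ 3)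
        (active B' (nextState B x a)).card (F (active B' (nextState B x a)).card) := key
  rw [hlhs, mul_comm _ (Fintype.card (Fin n → Choice n k 3) : ℝ), ← nsmul_eq_mul]
  refine Finset.sum_le_card_nsmul _ _ _ fun a _ => ?_
  have hrhs : thresholdPotential v B x = potential (100 / n) (p - 1 / 2) := by
    rw [thresholdPotential, if_pos hU, hp]
  have hm : (active B' (nextState B x a)).card ≤ n := by
    simpa using Finset.card_le_univ (active B' (nextState B x a))
  generalize (active B' (nextState B x a)).card = m at hm ⊢
  rw [hrhs]
  by_cases h : (n : ℝ) / 4 ≤ m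
  · have hF : F m = fun j : ℕ => potential (100 / n) ((j : ℝ) / m - 1 / 2) := by
      funext j; exact if_pos h
    rw [hF]
    exact binomialMean_potential_le hn h hm hp01.1 hp01.2
  · have hF : F m = fun _ => 0 + 0 * (0 : ℝ) + 0 * 0 := by
      funext j; simp only [F, if_neg h]; ring
    rw [hF, binomialMean_linear _ _ 0 0 0 (fun _ => 0) (fun _ => 0)]
    have := potential_nonneg (κ := 100 / (n : ℝ)) (by positivity) hp01.1 hp01.2
    nlinarith

end Round

/-! ### Resampling a round, and measurability -/

section Measure

open scoped ENNReal

variable {n k ℓ : ℕ}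

instance : MeasurableSingletonClass (Choice n k ℓ) := ⟨fun _ => trivial⟩

/-- The law of the choices of all servers in one round. -/
noncomputable def roundLaw (n k ℓ : ℕ) [NeZero n] : Measure (Fin n → Choice n k ℓ) :=
  Measure.pi fun _ : Fin n => (PMF.uniformOfFintype (Choice n k ℓ)).toMeasure

instance [NeZero n] : IsProbabilityMeasure (roundLaw n k ℓ) :=
  inferInstanceAs (IsProbabilityMeasure (Measure.pi _))

instance [NeZero n] : IsProbabilityMeasure (choiceLaw n k ℓ) :=
  inferInstanceAs (IsProbabilityMeasure (Measure.infinitePi _))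

theorem lintegral_roundLaw [NeZero n] (f : (Fin n → Choice n k ℓ) → ℝ≥0∞) :
    ∫⁻ a, f a ∂roundLaw n k ℓ = (∑ a, f a) / Fintype.card (Fin n → Choice n k ℓ) := by
  rw [lintegral_fintype, div_eq_mul_inv, Finset.sum_mul]
  refine Finset.sum_congr rfl fun a _ => ?_
  congr 1
  rw [roundLaw, Measure.pi_singleton]
  simp only [PMF.toMeasure_apply_singleton _ _ (measurableSet_singleton _),
    PMF.uniformOfFintype_apply, Finset.prod_const, Finset.card_univ, Fintype.card_fin]
  rw [← ENNReal.inv_pow]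
  congr 1
  simp

theorem measurable_resample (t : ℕ) :
    Measurable fun p : Outcome n k ℓ × (Fin n → Choice n k ℓ) => Function.update p.1 t p.2 := by
  rw [measurable_pi_iff]
  intro r
  by_cases hr : r = t
  · subst hr; simpa using measurable_snd
  · simp only [Function.update_of_ne hr]
    exact (measurable_pi_apply r).comp measurable_fst

/-- Replacing the choices of round `t` by a fresh copy does not change the law of the choices. -/
theorem choiceLaw_resample [NeZero n] (t : ℕ) :
    ((choiceLaw n k ℓ).prod (roundLaw n k ℓ)).map
      (fun p : Outcome n k ℓ × (Fin n → Choice n k ℓ) => Function.update p.1 t p.2) =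
      choiceLaw n k ℓ := by
  refine Measure.eq_infinitePi _ fun s u hu => ?_
  rw [Measure.map_apply (measurable_resample t)
    (MeasurableSet.pi s.countable_toSet fun i _ => hu i)]
  have hpre : (fun p : Outcome n k ℓ × (Fin n → Choice n k ℓ) => Function.update p.1 t p.2) ⁻¹'
      (Set.pi s u) = (Set.pi (s.erase t : Finset ℕ) u) ×ˢ (if t ∈ s then u t else Set.univ) := by
    ext ⟨ω, a⟩
    simp only [Set.mem_preimage, Set.mem_pi, Finset.mem_coe, Set.mem_prod, Finset.mem_erase]
    constructor
    · intro h
      refine ⟨fun i hi => by simpa [Function.update_of_ne hi.1] using h i hi.2, ?_⟩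
      split_ifs with ht
      · simpa using h t ht
      · trivial
    · rintro ⟨h1, h2⟩ i hi
      by_cases hit : i = t
      · subst hit; simpa [hi] using h2
      · simpa [Function.update_of_ne hit] using h1 i ⟨hit, hi⟩
  rw [hpre, Measure.prod_prod, choiceLaw, Measure.infinitePi_pi _ fun i _ => hu i]
  by_cases ht : t ∈ s
  · rw [if_pos ht]
    exact Finset.prod_erase_mul s (fun i => roundLaw n k ℓ (u i)) ht
  · rw [if_neg ht, measure_univ, mul_one, Finset.erase_eq_of_notMem ht]

/-- An expectation can be computed by first averaging over the choices of round `t`. -/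
theorem lintegral_choiceLaw_resample [NeZero n] (t : ℕ) {f : Outcome n k ℓ → ℝ≥0∞}
    (hf : Measurable f) :
    ∫⁻ ω, f ω ∂choiceLaw n k ℓ =
      ∫⁻ ω, (∑ a, f (Function.update ω t a)) / Fintype.card (Fin n → Choice n k ℓ)
        ∂choiceLaw n k ℓ := by
  have hmeas := measurable_resample (n := n) (k := k) (ℓ := ℓ) t
  conv_lhs => rw [← choiceLaw_resample t, lintegral_map hf hmeas]
  refine (lintegral_prod _ (hf.comp hmeas).aemeasurable).trans ?_
  simp only [Function.comp_apply, lintegral_roundLaw]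

theorem measurable_of_prefix {β γ : Type*} [MeasurableSpace β] [Finite β] [Nonempty β]
    [MeasurableSingletonClass β] [MeasurableSpace γ] {f : (ℕ → β) → γ} (t : ℕ)
    (hf : ∀ ω ω', (∀ r < t, ω r = ω' r) → f ω = f ω') : Measurable f := by
  obtain ⟨b⟩ := ‹Nonempty β›
  have h : f = (fun π : Fin t → β => f fun r => if h : r < t then π ⟨r, h⟩ else b) ∘
      fun ω i => ω i := by
    funext ω
    exact hf _ _ fun r hr => by simp [hr]
  rw [h]
  exact (measurable_of_finite _).comp (measurable_pi_lambda _ fun i => measurable_pi_apply _)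

/-- If averaging over round `t` contracts `f (t + 1)` to at most `ρ * f t`, where `f t` depends
only on the rounds before `t`, then the expectation of `f t` decays like `ρ ^ t`. -/
theorem lintegral_le_pow_of_contraction [NeZero n] {f : ℕ → Outcome n k ℓ → ℝ} {ρ M : ℝ}
    (hρ : 0 ≤ ρ) (hf0 : ∀ t ω, 0 ≤ f t ω)
    (hf : ∀ t ω ω', (∀ r < t, ω r = ω' r) → f t ω = f t ω') (hM : ∀ ω, f 0 ω ≤ M)
    (hstep : ∀ t ω, ∑ a, f (t + 1) (Function.update ω t a) ≤
      ρ * f t ω * Fintype.card (Fin n → Choice n k ℓ)) (t : ℕ) :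
    ∫⁻ ω, ENNReal.ofReal (f t ω) ∂choiceLaw n k ℓ ≤ ENNReal.ofReal (ρ ^ t * M) := by
  have hm : ∀ t, Measurable fun ω => ENNReal.ofReal (f t ω) := fun t =>
    measurable_of_prefix t fun ω ω' h => by rw [hf t ω ω' h]
  induction t with
  | zero =>
    calc ∫⁻ ω, ENNReal.ofReal (f 0 ω) ∂choiceLaw n k ℓ
        ≤ ∫⁻ _, ENNReal.ofReal M ∂choiceLaw n k ℓ :=
          lintegral_mono fun ω => ENNReal.ofReal_le_ofReal (hM ω)
      _ = ENNReal.ofReal (ρ ^ 0 * M) := by simp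
  | succ t ih =>
    rw [lintegral_choiceLaw_resample t (hm (t + 1))]
    have hcard : (0 : ℝ) < Fintype.card (Fin n → Choice n k ℓ) := by
      exact_mod_cast Fintype.card_pos
    calc ∫⁻ ω, (∑ a, ENNReal.ofReal (f (t + 1) (Function.update ω t a))) /
            Fintype.card (Fin n → Choice n k ℓ) ∂choiceLaw n k ℓ
        ≤ ∫⁻ ω, ENNReal.ofReal ρ * ENNReal.ofReal (f t ω) ∂choiceLaw n k ℓ := by
          refine lintegral_mono fun ω => ?_
          rw [← ENNReal.ofReal_sum_of_nonneg fun a _ => hf0 _ _, ← ENNReal.ofReal_mul hρ,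
            ← ENNReal.ofReal_natCast, ← ENNReal.ofReal_div_of_pos hcard]
          refine ENNReal.ofReal_le_ofReal ?_
          rw [div_le_iff₀ hcard]
          exact hstep t ω
      _ = ENNReal.ofReal ρ * ∫⁻ ω, ENNReal.ofReal (f t ω) ∂choiceLaw n k ℓ :=
          lintegral_const_mul _ (hm t)
      _ ≤ ENNReal.ofReal ρ * ENNReal.ofReal (ρ ^ t * M) := by gcongr
      _ = ENNReal.ofReal (ρ ^ (t + 1) * M) := by
          rw [← ENNReal.ofReal_mul hρ]; congr 1; ring

theorem choiceLaw_le_of_card_le [NeZero n] {t : ℕ} {E : Set (Outcome n k ℓ)} {ε : ℝ}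
    (hE : ∀ ω ω', (∀ r < t + 1, ω r = ω' r) → (ω ∈ E ↔ ω' ∈ E))
    (h : ∀ ω, (Nat.card {a : Fin n → Choice n k ℓ // Function.update ω t a ∈ E} : ℝ) ≤
      ε * Fintype.card (Fin n → Choice n k ℓ)) :
    choiceLaw n k ℓ E ≤ ENNReal.ofReal ε := by
  classical
  have hEm : MeasurableSet E := by
    have : Measurable fun ω => ω ∈ E := measurable_of_prefix (t + 1) fun ω ω' h =>
      propext (hE ω ω' h)
    exact measurableSet_setOfPred.2 this
  rw [← lintegral_indicator_one hEm,
    lintegral_choiceLaw_resample t (measurable_one.indicator hEm)]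
  have hcard : (0 : ℝ) < Fintype.card (Fin n → Choice n k ℓ) := by
    exact_mod_cast Fintype.card_pos
  calc _ ≤ ∫⁻ _, ENNReal.ofReal ε ∂choiceLaw n k ℓ := by
        refine lintegral_mono fun ω => ?_
        have : ∑ a : Fin n → Choice n k ℓ, E.indicator (1 : Outcome n k ℓ → ℝ≥0∞)
            (Function.update ω t a) =
            ENNReal.ofReal (Nat.card {a : Fin n → Choice n k ℓ // Function.update ω t a ∈ E}) := by
          rw [ENNReal.ofReal_natCast, Nat.card_eq_fintype_card, Fintype.card_subtype,
            Finset.card_filter, Nat.cast_sum]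
          refine Finset.sum_congr rfl fun a _ => ?_
          simp [Set.indicator_apply]
        rw [this, ← ENNReal.ofReal_natCast, ← ENNReal.ofReal_div_of_pos hcard]
        refine ENNReal.ofReal_le_ofReal ?_
        rw [div_le_iff₀ hcard]
        exact h ω
    _ = ENNReal.ofReal ε := by simp

variable {S : Type*} [MeasurableSpace S]

/-- An event that depends only on the blocked sets and the choices in finitely many rounds is a
finite union of measurable rectangles, as a late adversary sees only finitely many past choices.
-/
theorem Adversary.measurableSet_of_prefix [NeZero n] {A : Adversary S n k ℓ} {α : ℕ}
    (hA : A.IsLate α) (t : ℕ) {D : (ℕ → Finset (Fin n)) → Outcome n k ℓ → Prop}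
    (hD : ∀ B B' ω ω', (∀ r < t, B r = B' r) → (∀ r < t, ω r = ω' r) → (D B ω ↔ D B' ω')) :
    MeasurableSet {p : S × Outcome n k ℓ | D (A.block p.1 p.2) p.2} := by
  obtain ⟨a₀⟩ : Nonempty (Fin n → Choice n k ℓ) := inferInstance
  let extB : (Fin t → Finset (Fin n)) → ℕ → Finset (Fin n) := fun b r =>
    if h : r < t then b ⟨r, h⟩ else ∅
  let extω : (Fin t → Fin n → Choice n k ℓ) → Outcome n k ℓ := fun π r =>
    if h : r < t then π ⟨r, h⟩ else a₀
  have hE : {p : S × Outcome n k ℓ | D (A.block p.1 p.2) p.2} =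
      ⋃ q : {q : (Fin t → Finset (Fin n)) × (Fin t → Fin n → Choice n k ℓ) //
          D (extB q.1) (extω q.2)},
        {s | ∀ r : Fin t, A.block s (extω q.1.2) r = q.1.1 r} ×ˢ
          {ω | ∀ r : Fin t, ω r = q.1.2 r} := by
    ext ⟨s, ω⟩
    have hblock : ∀ π : Fin t → Fin n → Choice n k ℓ, (∀ r : Fin t, ω r = π r) →
        ∀ r < t, A.block s (extω π) r = A.block s ω r := by
      intro π hπ r hr
      refine hA s r _ _ fun r' hr' => ?_
      have : r' < t := by omega
      simp only [extω, this, dif_pos]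
      exact (hπ ⟨r', this⟩).symm
    simp only [Set.mem_ofPred_eq, Set.mem_iUnion, Set.mem_prod, Subtype.exists, Prod.exists,
      exists_prop]
    constructor
    · intro h
      refine ⟨fun r => A.block s ω r, fun r => ω r, ?_, fun r => hblock _ (fun _ => rfl) r r.2,
        fun _ => rfl⟩
      exact (hD _ _ _ _ (fun r hr => by simp [extB, hr]) (fun r hr => by simp [extω, hr])).1 h
    · rintro ⟨b, π, h, h1, h2⟩
      refine (hD _ _ _ _ (fun r hr => ?_) (fun r hr => ?_)).1 h
      · simp only [extB, hr, dif_pos]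
        rw [← hblock π h2 r hr]
        exact (h1 ⟨r, hr⟩).symm
      · simp only [extω, hr, dif_pos]
        exact (h2 ⟨r, hr⟩).symm
  rw [hE]
  refine MeasurableSet.iUnion fun q => MeasurableSet.prod ?_ ?_
  · rw [Set.ofPred_forall]
    exact MeasurableSet.iInter fun r => A.measurable_block _ _ _
  · rw [Set.ofPred_forall]
    exact MeasurableSet.iInter fun r => measurable_pi_apply (r : ℕ) (measurableSet_singleton _)

theorem prod_measure_le {Ω : Type*} [MeasurableSpace Ω] (ν : Measure S) [IsProbabilityMeasure ν]
    (μ : Measure Ω) [SFinite μ] {E : Set (S × Ω)} (hE : MeasurableSet E) {ε : ℝ≥0∞}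
    (h : ∀ s, μ {ω | (s, ω) ∈ E} ≤ ε) : ν.prod μ E ≤ ε := by
  rw [Measure.prod_apply hE]
  calc ∫⁻ s, μ (Prod.mk s ⁻¹' E) ∂ν ≤ ∫⁻ _, ε ∂ν := lintegral_mono h
    _ = ε := by simp

end Measure

/-! ### Availability after one round -/

section Availability

variable {K : Type*} [LinearOrder K] {n : ℕ}

/-- At most two replies means at least four unanswered requests among six; the bound
`15 / 256 = Nat.choose 6 4 * (1 / 4) ^ 4` is the union bound over the four positions. -/
theorem card_targets_few_le {U : Finset (Fin n)} (hU : 3 / 4 * (n : ℝ) ≤ U.card) :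
    ((Finset.univ.filter fun τ : Fin 6 → Fin n =>
      ¬ 3 ≤ (Finset.univ.filter fun j => τ j ∈ U).card).card : ℝ) ≤ 15 / 256 * (n : ℝ) ^ 6 := by
  have hsub : (Finset.univ.filter fun τ : Fin 6 → Fin n =>
      ¬ 3 ≤ (Finset.univ.filter fun j => τ j ∈ U).card) ⊆
      (Finset.powersetCard 4 (Finset.univ : Finset (Fin 6))).biUnion fun M =>
        Fintype.piFinset fun j => if j ∈ M then Uᶜ else Finset.univ := by
    intro τ hτ
    have h1 := Finset.card_filter_add_card_filter_not (s := (Finset.univ : Finset (Fin 6)))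
      (fun j => τ j ∈ U)
    simp only [Finset.mem_filter, Finset.mem_univ, true_and] at hτ
    rw [Finset.card_univ, Fintype.card_fin] at h1
    obtain ⟨M, hM, hM4⟩ := Finset.exists_subset_card_eq
      (show 4 ≤ (Finset.univ.filter fun j => ¬ τ j ∈ U).card by omega)
    refine Finset.mem_biUnion.2 ⟨M, by simp [hM4], Fintype.mem_piFinset.2 fun j => ?_⟩
    split_ifs with hj
    · simpa using hM hj
    · simp
  have hcard : ∀ M ∈ Finset.powersetCard 4 (Finset.univ : Finset (Fin 6)),
      (Fintype.piFinset fun j => if j ∈ M then Uᶜ else Finset.univ).card =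
        Uᶜ.card ^ 4 * n ^ 2 := by
    intro M hM
    have hM4 := (Finset.mem_powersetCard.1 hM).2
    rw [Fintype.card_piFinset]
    have : ∀ j : Fin 6, (if j ∈ M then Uᶜ else Finset.univ).card =
        if j ∈ M then Uᶜ.card else n := by
      intro j; split_ifs <;> simp
    simp only [this]
    rw [Finset.prod_ite, Finset.prod_const, Finset.prod_const]
    have h1 := Finset.card_filter_add_card_filter_not (s := (Finset.univ : Finset (Fin 6)))
      (fun j => j ∈ M)
    rw [Finset.card_univ, Fintype.card_fin] at h1
    have h2 : (Finset.univ.filter fun j => j ∈ M).card = 4 := by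
      rw [Finset.filter_univ_mem, hM4]
    rw [h2] at h1 ⊢
    congr 2
    omega
  have h := (Finset.card_le_card hsub).trans (Finset.card_biUnion_le)
  rw [Finset.sum_congr rfl hcard, Finset.sum_const, Finset.card_powersetCard, Finset.card_univ,
    Fintype.card_fin, show Nat.choose 6 4 = 15 by decide] at h
  have hc : (Uᶜ.card : ℝ) ≤ n / 4 := by
    have : (U.card : ℝ) + Uᶜ.card = n := by
      exact_mod_cast (Finset.card_add_card_compl U).trans (Fintype.card_fin n)
    linarith
  calc _ ≤ ((15 • (Uᶜ.card ^ 4 * n ^ 2) : ℕ) : ℝ) := by exact_mod_cast h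
    _ = 15 * ((Uᶜ.card : ℝ) ^ 4 * n ^ 2) := by simp
    _ ≤ 15 * ((n / 4 : ℝ) ^ 4 * n ^ 2) := by gcongr
    _ = _ := by ring

theorem card_choice_of_targets {k ℓ : ℕ} (P : (Fin k → Fin n) → Prop) [DecidablePred P] :
    (Finset.univ.filter fun c : Choice n k ℓ => P c.1).card * n ^ k =
      (Finset.univ.filter P).card * Fintype.card (Choice n k ℓ) := by
  have hprod : (Finset.univ.filter fun c : Choice n k ℓ => P c.1).card =
        (Finset.univ.filter P).card * Fintype.card ((A : {A : Finset (Fin k) // ℓ ≤ A.card}) →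
          {L : Finset (Fin k) // L ⊆ A.1 ∧ L.card = ℓ}) := by
    rw [← Finset.card_univ, ← Finset.card_product]
    refine congrArg Finset.card ?_
    ext c
    refine Finset.mem_filter.trans (Iff.trans ?_ Finset.mem_product.symm)
    exact ⟨fun h => ⟨Finset.mem_filter.2 ⟨Finset.mem_univ _, h.2⟩, Finset.mem_univ _⟩,
      fun h => ⟨Finset.mem_univ _, (Finset.mem_filter.1 h.1).2⟩⟩
  have htotal : Fintype.card (Choice n k ℓ) =
      n ^ k * Fintype.card ((A : {A : Finset (Fin k) // ℓ ≤ A.card}) →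
          {L : Finset (Fin k) // L ⊆ A.1 ∧ L.card = ℓ}) := by
    refine (Fintype.card_prod _ _).trans (congrArg (· * _) ?_)
    rw [Fintype.card_fun, Fintype.card_fin, Fintype.card_fin]
  rw [hprod, htotal]
  ring

theorem card_choice_few_le {U : Finset (Fin n)} (hU : 3 / 4 * (n : ℝ) ≤ U.card) :
    ((Finset.univ.filter fun c : Choice n 6 3 =>
      ¬ 3 ≤ (Finset.univ.filter fun j => c.1 j ∈ U).card).card : ℝ) ≤
      15 / 256 * Fintype.card (Choice n 6 3) := by
  rcases Nat.eq_zero_or_pos n with rfl | hn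
  · have : (Finset.univ.filter fun c : Choice 0 6 3 =>
        ¬ 3 ≤ (Finset.univ.filter fun j => c.1 j ∈ U).card) = ∅ :=
      Finset.eq_empty_of_forall_notMem fun c => (c.1 0).elim0
    rw [this, Finset.card_empty, Nat.cast_zero]
    positivity
  have h := card_choice_of_targets (k := 6) (ℓ := 3)
    fun τ : Fin 6 → Fin n => ¬ 3 ≤ (Finset.univ.filter fun j => τ j ∈ U).card
  have h' := congrArg (Nat.cast : ℕ → ℝ) h
  rw [Nat.cast_mul, Nat.cast_mul, Nat.cast_pow] at h'
  have hn' : (0 : ℝ) < (n : ℝ) ^ 6 := by positivity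
  refine le_of_mul_le_mul_right ?_ hn'
  rw [h', mul_right_comm]
  exact mul_le_mul_of_nonneg_right (card_targets_few_le hU) (Nat.cast_nonneg _)

theorem sum_pow_card_undecided_le {B : Finset (Fin n)} {x : Fin n → Option K}
    (hU : 3 / 4 * (n : ℝ) ≤ (active B x).card) (V : Finset (Fin n)) (hV : Disjoint V B) {b : ℝ}
    (hb : 1 ≤ b) :
    ∑ a : Fin n → Choice n 6 3, b ^ (V.filter fun i => ¬ (nextState B x a i).isSome).card ≤
      (1 + (b - 1) * (15 / 256)) ^ V.card * Fintype.card (Fin n → Choice n 6 3) := by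
  let f : Fin n → Choice n 6 3 → ℝ := fun i c =>
    if i ∈ V ∧ ¬ (newValue c fun j => reply B x i (c.1 j)).isSome then b else 1
  have h1 : ∀ a : Fin n → Choice n 6 3,
      b ^ (V.filter fun i => ¬ (nextState B x a i).isSome).card = ∏ i, f i (a i) := by
    intro a
    rw [Finset.prod_ite, Finset.prod_const, Finset.prod_const_one, mul_one]
    congr 2
    ext i
    simp [nextState]
  have h2 := Finset.prod_univ_sum (fun _ : Fin n => (Finset.univ : Finset (Choice n 6 3))) f
  rw [Fintype.piFinset_univ] at h2
  rw [Finset.sum_congr rfl fun a _ => h1 a, ← h2]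
  have h3 : ∀ i, ∑ c, f i c ≤ (if i ∈ V then 1 + (b - 1) * (15 / 256) else 1) *
      Fintype.card (Choice n 6 3) := by
    intro i
    by_cases hi : i ∈ V
    · have hiB : i ∉ B := Finset.disjoint_left.1 hV hi
      have : ∀ c, f i c = 1 + (b - 1) *
          if ¬ 3 ≤ (Finset.univ.filter fun j => c.1 j ∈ active B x).card then 1 else 0 := by
        intro c
        simp only [f, hi, true_and, newValue_reply_isSome_iff hiB (show 0 < 3 by norm_num)]
        split_ifs <;> ring
      have hcount := card_choice_few_le hU
      rw [Finset.natCast_card_filter] at hcount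
      simp only [this, Finset.sum_add_distrib, ← Finset.mul_sum, hi, if_true]
      have hb1 := mul_le_mul_of_nonneg_left hcount (by linarith : 0 ≤ b - 1)
      simp only [Finset.sum_const, Finset.card_univ, nsmul_eq_mul, mul_one]
      linarith
    · simp [f, hi]
  have h0 : ∀ i c, 0 ≤ f i c := by
    intro i c; simp only [f]; split_ifs <;> linarith
  refine (Finset.prod_le_prod (fun i _ => Finset.sum_nonneg fun c _ => h0 i c)
    fun i _ => h3 i).trans (le_of_eq ?_)
  rw [Finset.prod_mul_distrib, Finset.prod_ite_mem, Finset.univ_inter, Finset.prod_const,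
    Finset.prod_const]
  simp

/-- Chernoff bound for the number of useful servers. At least `4 / 5` of the servers are unblocked
in both rounds, and each of them becomes undecided with probability at most `15 / 256 < 1 / 16`.
-/
theorem exists_card_few_active_le : ∃ θ : ℝ, 0 < θ ∧ θ < 1 ∧
    ∀ (n : ℕ) (K : Type*) [LinearOrder K] (B B' : Finset (Fin n)) (x : Fin n → Option K),
      (B.card : ℝ) ≤ 1 / 10 * n → (B'.card : ℝ) ≤ 1 / 10 * n →
      3 / 4 * (n : ℝ) ≤ (active B x).card →
      ((Finset.univ.filter fun a : Fin n → Choice n 6 3 =>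
        ((active B' (nextState B x a)).card : ℝ) < 3 / 4 * n).card : ℝ) ≤
        θ ^ (n / 2) * Fintype.card (Fin n → Choice n 6 3) := by
  -- Markov's inequality for `1.1 ^ #undecided`: the base `1.1` is close enough to `1` for
  -- `(1 + 0.1 * (15 / 256)) ^ 16 < 1.1`
  obtain ⟨β, hβ0, hβ⟩ : ∃ β : ℝ, 0 < β ∧ β ^ 16 = 1.1 :=
    ⟨(1.1 : ℝ) ^ ((1 : ℝ) / 16), by positivity, by
      rw [← Real.rpow_natCast, ← Real.rpow_mul (by norm_num)]; norm_num⟩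
  have hβ1 : 1 ≤ β := by
    by_contra h
    have := pow_le_one₀ (n := 16) hβ0.le (not_le.1 h).le
    rw [hβ] at this; norm_num at this
  obtain ⟨q, hq⟩ : ∃ q : ℝ, q = 1 + (1.1 - 1) * (15 / 256) := ⟨_, rfl⟩
  have hq0 : 0 < q := by rw [hq]; norm_num
  have hqβ : q < β := by
    refine lt_of_pow_lt_pow_left₀ 16 hβ0.le ?_
    rw [hβ, hq]; norm_num
  refine ⟨q / β, by positivity, (div_lt_one hβ0).2 hqβ, ?_⟩
  intro n K _ B B' x hB hB' hU
  set V : Finset (Fin n) := (B ∪ B')ᶜ with hVd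
  have hVB : Disjoint V B := by
    rw [Finset.disjoint_left]; intro i hi hiB
    exact (Finset.mem_compl.1 hi) (Finset.mem_union_left _ hiB)
  have hVcard : 4 / 5 * (n : ℝ) ≤ V.card := by
    have h1 : ((B ∪ B').card : ℝ) + V.card = n := by
      exact_mod_cast (Finset.card_add_card_compl (B ∪ B')).trans (Fintype.card_fin n)
    have h2 : ((B ∪ B').card : ℝ) ≤ B.card + B'.card := by
      exact_mod_cast Finset.card_union_le B B'
    linarith
  have hVn : n / 2 ≤ V.card := by
    have : (n : ℝ) ≤ 2 * V.card := by linarith [(Nat.cast_nonneg n : (0 : ℝ) ≤ n)]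
    have : n ≤ 2 * V.card := by exact_mod_cast this
    omega
  have hsum := sum_pow_card_undecided_le hU V hVB (b := 1.1) (by norm_num)
  rw [← hq] at hsum
  set bad := Finset.univ.filter fun a : Fin n → Choice n 6 3 =>
        ((active B' (nextState B x a)).card : ℝ) < 3 / 4 * n with hbad
  have hmarkov : (bad.card : ℝ) * β ^ V.card ≤ ∑ a : Fin n → Choice n 6 3,
      (1.1 : ℝ) ^ (V.filter fun i => ¬ (nextState B x a i).isSome).card := by
    rw [← nsmul_eq_mul]
    refine (Finset.card_nsmul_le_sum bad _ _ fun a ha => ?_).trans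
      (Finset.sum_le_univ_sum_of_nonneg fun a => by positivity)
    have h1 : V.card ≤ (active B' (nextState B x a)).card +
        (V.filter fun i => ¬ (nextState B x a i).isSome).card := by
      rw [← Finset.card_filter_add_card_filter_not (s := V) (fun i => (nextState B x a i).isSome)]
      gcongr
      intro i hi
      simp only [Finset.mem_filter, hVd, Finset.mem_compl, Finset.mem_union, not_or, active,
        Finset.mem_univ, true_and] at hi ⊢
      exact ⟨hi.1.2, hi.2⟩
    have h2 := (Finset.mem_filter.1 ha).2
    have h3 : (V.card : ℝ) ≤ (active B' (nextState B x a)).card +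
        (V.filter fun i => ¬ (nextState B x a i).isSome).card := by exact_mod_cast h1
    -- `3 / 4 = 15 / 16 * (4 / 5)`, so more than a `1 / 16`-fraction of `V` is undecided
    have h4 : (V.card : ℝ) ≤
        16 * (V.filter fun i => ¬ (nextState B x a i).isSome).card := by linarith
    have h5 : V.card ≤ 16 * (V.filter fun i => ¬ (nextState B x a i).isSome).card := by
      exact_mod_cast h4
    rw [← hβ, ← pow_mul]
    exact pow_le_pow_right₀ hβ1 h5
  have hfin : (bad.card : ℝ) ≤ (q / β) ^ V.card * Fintype.card (Fin n → Choice n 6 3) := by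
    rw [div_pow, div_mul_eq_mul_div, le_div_iff₀ (by positivity)]
    exact hmarkov.trans hsum
  refine hfin.trans ?_
  gcongr ?_ * _
  exact pow_le_pow_of_le_one (by positivity) ((div_lt_one hβ0).2 hqβ).le hVn

end Availability

/-! ### Executions against a late adversary -/

section Execution

variable {K : Type*} [LinearOrder K] {n k ℓ : ℕ}

theorem state_succ (x₀ : Fin n → K) (B : ℕ → Finset (Fin n)) (ω : Outcome n k ℓ) (t : ℕ) :
    state x₀ B ω (t + 1) = nextState (B t) (state x₀ B ω t) (ω t) := rfl

theorem useful_eq_active {K : Type*} {n : ℕ} (x : ℕ → Fin n → Option K)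
    (B : ℕ → Finset (Fin n)) (t : ℕ) : useful x B t = active (B t) (x t) := rfl

theorem state_congr (x₀ : Fin n → K) {B B' : ℕ → Finset (Fin n)} {ω ω' : Outcome n k ℓ} {t : ℕ}
    (hB : ∀ r < t, B r = B' r) (hω : ∀ r < t, ω r = ω' r) :
    state x₀ B ω t = state x₀ B' ω' t := by
  induction t with
  | zero => rfl
  | succ t ih =>
    rw [state_succ, state_succ, ih (fun r hr => hB r (by omega)) (fun r hr => hω r (by omega)),
      hB t (by omega), hω t (by omega)]

theorem exists_active_eq_of_nextState_eq {B : Finset (Fin n)} {x : Fin n → Option K}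
    {a : Fin n → Choice n k ℓ} {i : Fin n} {y : K} (h : nextState B x a i = some y) :
    ∃ j ∈ active B x, x j = some y := by
  obtain ⟨r, hr⟩ := exists_reply_eq_newValue h
  unfold reply at hr
  split_ifs at hr with hB
  exact ⟨_, by simp [active, hr, not_or.1 hB], hr⟩

theorem state_mem_range (x₀ : Fin n → K) (B : ℕ → Finset (Fin n)) (ω : Outcome n k ℓ) {t : ℕ}
    {i : Fin n} {y : K} (h : state x₀ B ω t i = some y) : ∃ j, x₀ j = y := by
  induction t generalizing i with
  | zero => exact ⟨i, Option.some_injective _ h⟩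
  | succ t ih =>
    obtain ⟨j, -, hj⟩ := exists_active_eq_of_nextState_eq h
    exact ih hj

/-- Agreement persists, as every new value is copied from a useful server. -/
theorem agreement_persists (x₀ : Fin n → K) (B : ℕ → Finset (Fin n)) (ω : Outcome n k ℓ)
    {τ t : ℕ} (hτ : τ ≤ t) {v : K}
    (h : ∀ i ∈ useful (state x₀ B ω) B τ, state x₀ B ω τ i = some v) :
    ∀ i ∈ useful (state x₀ B ω) B t, state x₀ B ω t i = some v := by
  induction t, hτ using Nat.le_induction with
  | base => exact h
  | succ t _ ih =>
    intro i hi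
    obtain ⟨y, hy⟩ := Option.isSome_iff_exists.1 (Finset.mem_filter.1 hi).2.2
    obtain ⟨j, hj, hjy⟩ := exists_active_eq_of_nextState_eq hy
    rw [hy, ← hjy, ih j hj]

/-- If the useful servers disagree, then some initial value separates them as a threshold. -/
theorem exists_threshold (x₀ : Fin n → K) [NeZero n] (B : ℕ → Finset (Fin n))
    (ω : Outcome n k ℓ) (τ : ℕ)
    (h : ¬ ∃ v : K, ∀ i ∈ useful (state x₀ B ω) B τ, state x₀ B ω τ i = some v) :
    ∃ j, 0 < (activeLE (x₀ j) (B τ) (state x₀ B ω τ)).card ∧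
      (activeLE (x₀ j) (B τ) (state x₀ B ω τ)).card < (active (B τ) (state x₀ B ω τ)).card := by
  push Not at h
  obtain ⟨i₀, hi₀, -⟩ := h (x₀ 0)
  obtain ⟨y₀, hy₀⟩ := Option.isSome_iff_exists.1 (Finset.mem_filter.1 hi₀).2.2
  obtain ⟨i₁, hi₁, hne⟩ := h y₀
  obtain ⟨y₁, hy₁⟩ := Option.isSome_iff_exists.1 (Finset.mem_filter.1 hi₁).2.2
  rw [hy₁, Ne, Option.some_inj] at hne
  have key : ∀ {i i' : Fin n} {y y' : K}, i ∈ useful (state x₀ B ω) B τ →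
      i' ∈ useful (state x₀ B ω) B τ → state x₀ B ω τ i = some y →
      state x₀ B ω τ i' = some y' → y < y' →
      ∃ j, 0 < (activeLE (x₀ j) (B τ) (state x₀ B ω τ)).card ∧
        (activeLE (x₀ j) (B τ) (state x₀ B ω τ)).card <
          (active (B τ) (state x₀ B ω τ)).card := by
    intro i i' y y' hi hi' hy hy' hlt
    obtain ⟨j, rfl⟩ := state_mem_range x₀ B ω hy
    refine ⟨j, Finset.card_pos.2 ⟨i, ?_⟩, Finset.card_lt_card ?_⟩
    · simp [activeLE, hy, (Finset.mem_filter.1 hi).2.1]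
    · refine Finset.ssubset_iff_of_subset (activeLE_subset _ _ _) |>.2 ⟨i', hi', ?_⟩
      simp [activeLE, hy', hlt]
  rcases lt_or_gt_of_ne hne with hlt | hlt
  · exact key hi₁ hi₀ hy₁ hy₀ hlt
  · exact key hi₀ hi₁ hy₀ hy₁ hlt

theorem solvesStabilizingConsensus_of_agreement (x₀ : Fin n → K) (B : ℕ → Finset (Fin n))
    (ω : Outcome n k ℓ) {τ : ℝ} {δ : ℝ} {T : ℕ}
    (h : ∃ v : K, ∀ i ∈ useful (state x₀ B ω) B ⌈τ⌉₊, state x₀ B ω ⌈τ⌉₊ i = some v)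
    (hT : ∀ t ≤ T, δ * n ≤ ((useful (state x₀ B ω) B t).card : ℝ)) :
    SolvesStabilizingConsensus (state x₀ B ω) (useful (state x₀ B ω) B) τ δ T where
  agreement := by
    obtain ⟨v, hv⟩ := h
    exact ⟨v, fun t ht => agreement_persists x₀ B ω (Nat.ceil_le.2 ht) hv⟩
  availability := hT
  validity t i v hv := by
    obtain ⟨j, -, hj⟩ := exists_active_eq_of_nextState_eq hv
    exact ⟨j, hj⟩

variable {S : Type*} [MeasurableSpace S] {A : Adversary S n k ℓ}

theorem Adversary.IsLate.block_congr {α : ℕ} (hA : A.IsLate α) (s : S) {ω ω' : Outcome n k ℓ}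
    {t r : ℕ} (h : ∀ q < t, ω q = ω' q) (hr : r ≤ t + α) : A.block s ω r = A.block s ω' r :=
  hA s r ω ω' fun q hq => h q (by omega)

theorem Adversary.IsLate.states_congr {α : ℕ} (hA : A.IsLate α) (x₀ : Fin n → K) (s : S)
    {ω ω' : Outcome n k ℓ} {t r : ℕ} (h : ∀ q < t, ω q = ω' q) (hr : r ≤ t) :
    A.states x₀ (s, ω) r = A.states x₀ (s, ω') r :=
  state_congr x₀ (fun _ _ => hA.block_congr s h (by omega)) fun q _ => h q (by omega)

theorem Adversary.IsLate.usefulSets_congr {α : ℕ} (hA : A.IsLate α) (x₀ : Fin n → K) (s : S)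
    {ω ω' : Outcome n k ℓ} {t r : ℕ} (h : ∀ q < t, ω q = ω' q) (hr : r ≤ t) :
    A.usefulSets x₀ (s, ω) r = A.usefulSets x₀ (s, ω') r := by
  change active (A.block s ω r) (A.states x₀ (s, ω) r) =
    active (A.block s ω' r) (A.states x₀ (s, ω') r)
  rw [hA.states_congr x₀ s h hr, hA.block_congr s h (by omega)]

theorem eq_update_of_lt (ω : Outcome n k ℓ) (t : ℕ) (a : Fin n → Choice n k ℓ) :
    ∀ q < t, Function.update ω t a q = ω q :=
  fun _ hq => Function.update_of_ne hq.ne _ _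

theorem Adversary.IsLate.states_update_succ {α : ℕ} (hA : A.IsLate α) (x₀ : Fin n → K) (s : S)
    (ω : Outcome n k ℓ) (t : ℕ) (a : Fin n → Choice n k ℓ) :
    A.states x₀ (s, Function.update ω t a) (t + 1) =
      nextState (A.block s ω t) (A.states x₀ (s, ω) t) a := by
  change nextState (A.block s (Function.update ω t a) t)
    (A.states x₀ (s, Function.update ω t a) t) (Function.update ω t a t) = _
  rw [hA.states_congr x₀ s (eq_update_of_lt ω t a) le_rfl,
    hA.block_congr s (eq_update_of_lt ω t a) (by omega), Function.update_self]

open Classical in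
/-- The potential for the threshold `v` in round `t`, killed once less than a quarter of the servers
has been useful in some round. -/
noncomputable def Adversary.killedPotential (A : Adversary S n k ℓ) (x₀ : Fin n → K) (v : K)
    (s : S) (t : ℕ) (ω : Outcome n k ℓ) : ℝ :=
  if ∀ r ≤ t, (n : ℝ) / 4 ≤ (A.usefulSets x₀ (s, ω) r).card then
    thresholdPotential v (A.block s ω t) (A.states x₀ (s, ω) t) else 0

theorem Adversary.killedPotential_nonneg (A : Adversary S n k ℓ) (x₀ : Fin n → K) (v : K)
    (s : S) (t : ℕ) (ω : Outcome n k ℓ) : 0 ≤ A.killedPotential x₀ v s t ω := by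
  unfold Adversary.killedPotential
  split_ifs
  exacts [thresholdPotential_nonneg _ _ _, le_rfl]

theorem Adversary.killedPotential_le (A : Adversary S n k ℓ) (x₀ : Fin n → K) (v : K)
    (s : S) (t : ℕ) (ω : Outcome n k ℓ) : A.killedPotential x₀ v s t ω ≤
      thresholdPotential v (A.block s ω t) (A.states x₀ (s, ω) t) := by
  unfold Adversary.killedPotential
  split_ifs
  exacts [le_rfl, thresholdPotential_nonneg _ _ _]

theorem Adversary.IsLate.killedPotential_congr {α : ℕ} (hA : A.IsLate α) (x₀ : Fin n → K) (v : K)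
    (s : S) (t : ℕ) (ω ω' : Outcome n k ℓ) (h : ∀ q < t, ω q = ω' q) :
    A.killedPotential x₀ v s t ω = A.killedPotential x₀ v s t ω' := by
  unfold Adversary.killedPotential
  have h1 : (∀ r ≤ t, (n : ℝ) / 4 ≤ (A.usefulSets x₀ (s, ω) r).card) ↔
      ∀ r ≤ t, (n : ℝ) / 4 ≤ (A.usefulSets x₀ (s, ω') r).card :=
    forall₂_congr fun r hr => by rw [hA.usefulSets_congr x₀ s h hr]
  simp only [h1, hA.states_congr x₀ s h le_rfl, hA.block_congr s h (by omega : t ≤ t + α)]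

/-- The blocked set of round `t + 1` does not see the choices of round `t`, so the contraction for a
single round applies. -/
theorem Adversary.IsLate.sum_killedPotential_le {A : Adversary S n k 3} (hA : A.IsLate 1)
    (hn : 400 ≤ n) (x₀ : Fin n → K) (v : K) (s : S) (t : ℕ) (ω : Outcome n k 3) :
    ∑ a, A.killedPotential x₀ v s (t + 1) (Function.update ω t a) ≤
      (1 - 1 / 4000) * A.killedPotential x₀ v s t ω * Fintype.card (Fin n → Choice n k 3) := by
  by_cases h : ∀ r ≤ t, (n : ℝ) / 4 ≤ (A.usefulSets x₀ (s, ω) r).card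
  · have h1 : A.killedPotential x₀ v s t ω =
        thresholdPotential v (A.block s ω t) (A.states x₀ (s, ω) t) := if_pos h
    rw [h1]
    refine le_trans (Finset.sum_le_sum fun a _ => ?_)
      (sum_thresholdPotential_le hn v (A.block s ω t) (A.block s ω (t + 1)) _ (h t le_rfl))
    refine (A.killedPotential_le x₀ v s (t + 1) _).trans (le_of_eq ?_)
    rw [hA.states_update_succ, hA.block_congr s (eq_update_of_lt ω t a) le_rfl]
  · have h1 : A.killedPotential x₀ v s t ω = 0 := if_neg h
    have h2 : ∀ a, A.killedPotential x₀ v s (t + 1) (Function.update ω t a) = 0 := by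
      refine fun a => if_neg fun h' => h fun r hr => ?_
      rw [← hA.usefulSets_congr x₀ s (eq_update_of_lt ω t a) hr]
      exact h' r (by omega)
    simp [h1, h2]

theorem thresholdPotential_le (v : K) (B : Finset (Fin n)) (x : Fin n → Option K) (hn : 0 < n) :
    thresholdPotential v B x ≤ n := by
  unfold thresholdPotential
  have hn' : (0 : ℝ) < n := by exact_mod_cast hn
  split_ifs
  · unfold potential
    set δ : ℝ := (activeLE v B x).card / (active B x).card - 1 / 2
    rw [div_le_iff₀ (by positivity)]
    have : (n : ℝ) * (100 / n + δ ^ 2) = 100 + n * δ ^ 2 := by field_simp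
    rw [this]
    nlinarith [sq_nonneg δ, mul_nonneg hn'.le (sq_nonneg δ)]
  · exact hn'.le

theorem le_thresholdPotential (v : K) (B : Finset (Fin n)) (x : Fin n → Option K) (hn : 400 ≤ n)
    (hU : (n : ℝ) / 4 ≤ (active B x).card) (h0 : 0 < (activeLE v B x).card)
    (h1 : (activeLE v B x).card < (active B x).card) :
    4 / (n : ℝ) ^ 2 ≤ thresholdPotential v B x := by
  have hn' : (400 : ℝ) ≤ n := by exact_mod_cast hn
  rw [thresholdPotential, if_pos hU, potential]
  have hun : ((active B x).card : ℝ) ≤ n := by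
    exact_mod_cast (Finset.card_le_univ (active B x)).trans_eq (Fintype.card_fin n)
  have ho : (1 : ℝ) ≤ (activeLE v B x).card := by exact_mod_cast h0
  have hou : ((activeLE v B x).card : ℝ) + 1 ≤ (active B x).card := by exact_mod_cast h1
  generalize ((activeLE v B x).card : ℝ) = o at *
  generalize ((active B x).card : ℝ) = u at *
  have hu : 0 < u := by linarith
  have hq0 : 0 ≤ o / u := by positivity
  have hq1 : o / u ≤ 1 := (div_le_one hu).2 (by linarith)
  have hκ : 100 / (n : ℝ) ≤ 1 / 4 := by
    rw [div_le_div_iff₀ (by linarith) (by norm_num)]; linarith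
  have hden : 100 / (n : ℝ) + (o / u - 1 / 2) ^ 2 ≤ 1 := by nlinarith
  have hden0 : 0 < 100 / (n : ℝ) + (o / u - 1 / 2) ^ 2 := by positivity
  have hnum : 1 - 4 * (o / u - 1 / 2) ^ 2 = 4 * (o * (u - o)) / u ^ 2 := by field_simp; ring
  have hou' : 1 ≤ o * (u - o) := by nlinarith
  calc 4 / (n : ℝ) ^ 2 ≤ 4 / u ^ 2 := by gcongr
    _ ≤ 1 - 4 * (o / u - 1 / 2) ^ 2 := by rw [hnum]; gcongr; linarith
    _ ≤ _ := by
      rw [le_div_iff₀ hden0]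
      have : 0 ≤ 1 - 4 * (o / u - 1 / 2) ^ 2 := by nlinarith
      nlinarith

/-- Markov's inequality for the killed potential: it is at least `4 / n ^ 2` as long as the useful
servers are separated by the threshold `v`. -/
theorem Adversary.IsLate.measure_split_le [NeZero n] {A : Adversary S n k 3} (hA : A.IsLate 1)
    (hn : 400 ≤ n) (x₀ : Fin n → K) (v : K) (s : S) (τ : ℕ) :
    choiceLaw n k 3 {ω | (∀ t ≤ τ, (n : ℝ) / 4 ≤ (A.usefulSets x₀ (s, ω) t).card) ∧
        0 < (activeLE v (A.block s ω τ) (A.states x₀ (s, ω) τ)).card ∧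
        (activeLE v (A.block s ω τ) (A.states x₀ (s, ω) τ)).card <
          (A.usefulSets x₀ (s, ω) τ).card} ≤
      ENNReal.ofReal ((1 - 1 / 4000) ^ τ * n ^ 3) := by
  have hn' : (0 : ℝ) < n := by exact_mod_cast (by omega : 0 < n)
  have hint := lintegral_le_pow_of_contraction (f := A.killedPotential x₀ v s) (M := n)
    (by norm_num : (0 : ℝ) ≤ 1 - 1 / 4000) (A.killedPotential_nonneg x₀ v s)
    (hA.killedPotential_congr x₀ v s)
    (fun ω => (A.killedPotential_le x₀ v s 0 ω).trans (thresholdPotential_le _ _ _ (by omega)))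
    (hA.sum_killedPotential_le hn x₀ v s) τ
  have hmeas : Measurable fun ω => ENNReal.ofReal (A.killedPotential x₀ v s τ ω) :=
    measurable_of_prefix τ fun ω ω' h => by rw [hA.killedPotential_congr x₀ v s τ ω ω' h]
  have hpos : 0 < 4 / (n : ℝ) ^ 2 := by positivity
  refine (measure_mono fun ω hω => ?_).trans
    ((meas_ge_le_lintegral_div hmeas.aemeasurable (ε := ENNReal.ofReal (4 / (n : ℝ) ^ 2))
      (by simpa using hpos) ENNReal.ofReal_ne_top).trans ?_)
  · change ENNReal.ofReal (4 / (n : ℝ) ^ 2) ≤ ENNReal.ofReal (A.killedPotential x₀ v s τ ω)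
    refine ENNReal.ofReal_le_ofReal ?_
    rw [Adversary.killedPotential, if_pos hω.1]
    exact le_thresholdPotential v _ _ hn (hω.1 τ le_rfl) hω.2.1 hω.2.2
  · refine (ENNReal.div_le_div_right hint _).trans ?_
    rw [← ENNReal.ofReal_div_of_pos hpos]
    refine ENNReal.ofReal_le_ofReal ?_
    have : (1 - 1 / 4000 : ℝ) ^ τ * n / (4 / n ^ 2) = (1 - 1 / 4000) ^ τ * n ^ 3 / 4 := by
      field_simp
    rw [this]
    have : (0 : ℝ) ≤ (1 - 1 / 4000) ^ τ * n ^ 3 := by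
      have : (0 : ℝ) ≤ 1 - 1 / 4000 := by norm_num
      positivity
    linarith

/-- Union bound over the initial values as thresholds. -/
theorem Adversary.IsLate.measure_no_agreement_le [NeZero n] {A : Adversary S n k 3}
    (hA : A.IsLate 1) (ν : Measure S) [IsProbabilityMeasure ν] (hn : 400 ≤ n) (x₀ : Fin n → K)
    (τ : ℕ) :
    (ν.prod (choiceLaw n k 3)) {p | (∀ t ≤ τ, (n : ℝ) / 4 ≤ (A.usefulSets x₀ p t).card) ∧
        ¬ ∃ v : K, ∀ i ∈ A.usefulSets x₀ p τ, A.states x₀ p τ i = some v} ≤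
      ENNReal.ofReal ((1 - 1 / 4000) ^ τ * n ^ 4) := by
  have hb : ∀ j : Fin n, (ν.prod (choiceLaw n k 3))
      {p | (∀ t ≤ τ, (n : ℝ) / 4 ≤ (A.usefulSets x₀ p t).card) ∧
        0 < (activeLE (x₀ j) (A.block p.1 p.2 τ) (A.states x₀ p τ)).card ∧
        (activeLE (x₀ j) (A.block p.1 p.2 τ) (A.states x₀ p τ)).card <
          (A.usefulSets x₀ p τ).card} ≤ ENNReal.ofReal ((1 - 1 / 4000) ^ τ * n ^ 3) := by
    intro j
    refine prod_measure_le ν _ ?_ fun s => hA.measure_split_le hn x₀ (x₀ j) s τ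
    refine Adversary.measurableSet_of_prefix hA (τ + 1)
      (D := fun B ω => (∀ t ≤ τ, (n : ℝ) / 4 ≤ (useful (state x₀ B ω) B t).card) ∧
        0 < (activeLE (x₀ j) (B τ) (state x₀ B ω τ)).card ∧
        (activeLE (x₀ j) (B τ) (state x₀ B ω τ)).card < (useful (state x₀ B ω) B τ).card) ?_
    intro B B' ω ω' hB hω
    have hx : ∀ t ≤ τ, state x₀ B ω t = state x₀ B' ω' t := fun t ht =>
      state_congr x₀ (fun r hr => hB r (by omega)) fun r hr => hω r (by omega)
    have hu : ∀ t ≤ τ, useful (state x₀ B ω) B t = useful (state x₀ B' ω') B' t := fun t ht => by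
      rw [useful_eq_active, useful_eq_active, hx t ht, hB t (by omega)]
    rw [hx τ le_rfl, hB τ (by omega), hu τ le_rfl]
    refine and_congr_left fun _ => forall₂_congr fun t ht => by rw [hu t ht]
  calc _ ≤ (ν.prod (choiceLaw n k 3)) (⋃ j : Fin n,
      {p | (∀ t ≤ τ, (n : ℝ) / 4 ≤ (A.usefulSets x₀ p t).card) ∧
        0 < (activeLE (x₀ j) (A.block p.1 p.2 τ) (A.states x₀ p τ)).card ∧
        (activeLE (x₀ j) (A.block p.1 p.2 τ) (A.states x₀ p τ)).card <
          (A.usefulSets x₀ p τ).card}) := by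
        refine measure_mono fun p hp => ?_
        obtain ⟨j, hj⟩ := exists_threshold x₀ (A.block p.1 p.2) p.2 τ hp.2
        exact Set.mem_iUnion.2 ⟨j, hp.1, hj⟩
    _ ≤ ∑ _j : Fin n, ENNReal.ofReal ((1 - 1 / 4000) ^ τ * n ^ 3) :=
        (measure_iUnion_fintype_le _ _).trans (Finset.sum_le_sum fun j _ => hb j)
    _ = ENNReal.ofReal ((1 - 1 / 4000) ^ τ * n ^ 4) := by
        rw [Finset.sum_const, Finset.card_univ, Fintype.card_fin, nsmul_eq_mul,
          ← ENNReal.ofReal_natCast, ← ENNReal.ofReal_mul (Nat.cast_nonneg n)]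
        congr 1; ring

theorem Adversary.IsLate.measure_availability_lost_le [NeZero n] {A : Adversary S n 6 3}
    (hA : A.IsLate 1) (hAb : A.IsBlocking (1 / 10)) (ν : Measure S) [IsProbabilityMeasure ν]
    (x₀ : Fin n → K) (t : ℕ) {ε : ℝ}
    (hε : ∀ (B B' : Finset (Fin n)) (x : Fin n → Option K),
      (B.card : ℝ) ≤ 1 / 10 * n → (B'.card : ℝ) ≤ 1 / 10 * n →
      3 / 4 * (n : ℝ) ≤ (active B x).card →
      ((Finset.univ.filter fun a : Fin n → Choice n 6 3 =>
        ((active B' (nextState B x a)).card : ℝ) < 3 / 4 * n).card : ℝ) ≤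
        ε * Fintype.card (Fin n → Choice n 6 3)) (hε0 : 0 ≤ ε) :
    (ν.prod (choiceLaw n 6 3)) {p | 3 / 4 * (n : ℝ) ≤ (A.usefulSets x₀ p t).card ∧
        ((A.usefulSets x₀ p (t + 1)).card : ℝ) < 3 / 4 * n} ≤ ENNReal.ofReal ε := by
  refine prod_measure_le ν _ ?_ fun s => ?_
  · refine Adversary.measurableSet_of_prefix hA (t + 2)
      (D := fun B ω => 3 / 4 * (n : ℝ) ≤ (useful (state x₀ B ω) B t).card ∧
        ((useful (state x₀ B ω) B (t + 1)).card : ℝ) < 3 / 4 * n) ?_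
    intro B B' ω ω' hB hω
    have hu : ∀ r ≤ t + 1, useful (state x₀ B ω) B r = useful (state x₀ B' ω') B' r :=
      fun r hr => by
        rw [useful_eq_active, useful_eq_active, hB r (by omega), state_congr x₀
          (fun q hq => hB q (by omega)) fun q hq => hω q (by omega)]
    rw [hu t (by omega), hu (t + 1) le_rfl]
  · refine choiceLaw_le_of_card_le (t := t) (fun ω ω' h => ?_) fun ω => ?_
    · change (_ ∧ _) ↔ (_ ∧ _)
      rw [hA.usefulSets_congr x₀ s h (by omega : t ≤ t + 1), hA.usefulSets_congr x₀ s h le_rfl]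
    · classical
      have hcongr : ∀ a, A.usefulSets x₀ (s, Function.update ω t a) t =
          A.usefulSets x₀ (s, ω) t := fun a =>
        hA.usefulSets_congr x₀ s (eq_update_of_lt ω t a) le_rfl
      by_cases h : 3 / 4 * (n : ℝ) ≤ (A.usefulSets x₀ (s, ω) t).card
      · have hsucc : ∀ a, A.usefulSets x₀ (s, Function.update ω t a) (t + 1) =
            active (A.block s ω (t + 1)) (nextState (A.block s ω t) (A.states x₀ (s, ω) t) a) := by
          intro a
          rw [← hA.states_update_succ,
            ← hA.block_congr s (eq_update_of_lt ω t a) (le_refl (t + 1))]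
          rfl
        rw [Nat.card_eq_fintype_card, Fintype.card_subtype]
        refine le_trans (Nat.cast_le.2 (Finset.card_le_card fun a ha => ?_))
          (hε (A.block s ω t) (A.block s ω (t + 1)) (A.states x₀ (s, ω) t) (hAb s ω t)
            (hAb s ω (t + 1)) h)
        have ha' := (Finset.mem_filter.1 ha).2.2
        rw [hsucc a] at ha'
        exact Finset.mem_filter.2 ⟨Finset.mem_univ _, ha'⟩
      · have : IsEmpty {a : Fin n → Choice n 6 3 // Function.update ω t a ∈
            {ω | (s, ω) ∈ {p | 3 / 4 * (n : ℝ) ≤ (A.usefulSets x₀ p t).card ∧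
              ((A.usefulSets x₀ p (t + 1)).card : ℝ) < 3 / 4 * n}}} := by
          refine ⟨fun a => h ?_⟩
          rw [← hcongr a.1]
          exact a.2.1
        rw [Nat.card_of_isEmpty, Nat.cast_zero]
        positivity

theorem Adversary.IsBlocking.le_card_usefulSets_zero {A : Adversary S n k ℓ}
    (hAb : A.IsBlocking (1 / 10)) (x₀ : Fin n → K) (p : S × Outcome n k ℓ) :
    3 / 4 * (n : ℝ) ≤ (A.usefulSets x₀ p 0).card := by
  have h1 : A.usefulSets x₀ p 0 = (A.block p.1 p.2 0)ᶜ := by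
    ext i
    simp [Adversary.usefulSets, Adversary.states, useful, state]
  have h2 : ((A.block p.1 p.2 0).card : ℝ) + (A.block p.1 p.2 0)ᶜ.card = n := by
    exact_mod_cast (Finset.card_add_card_compl _).trans (Fintype.card_fin n)
  have h3 := hAb p.1 p.2 0
  rw [h1]
  linarith [(Nat.cast_nonneg n : (0 : ℝ) ≤ n)]

theorem Adversary.IsLate.measure_availability_le [NeZero n] {A : Adversary S n 6 3}
    (hA : A.IsLate 1) (hAb : A.IsBlocking (1 / 10)) (ν : Measure S) [IsProbabilityMeasure ν]
    (x₀ : Fin n → K) (T : ℕ) {ε : ℝ}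
    (hε : ∀ (B B' : Finset (Fin n)) (x : Fin n → Option K),
      (B.card : ℝ) ≤ 1 / 10 * n → (B'.card : ℝ) ≤ 1 / 10 * n →
      3 / 4 * (n : ℝ) ≤ (active B x).card →
      ((Finset.univ.filter fun a : Fin n → Choice n 6 3 =>
        ((active B' (nextState B x a)).card : ℝ) < 3 / 4 * n).card : ℝ) ≤
        ε * Fintype.card (Fin n → Choice n 6 3)) (hε0 : 0 ≤ ε) :
    (ν.prod (choiceLaw n 6 3)) {p | ∃ t ≤ T, ((A.usefulSets x₀ p t).card : ℝ) < 3 / 4 * n} ≤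
      ENNReal.ofReal (T * ε) := by
  calc _ ≤ (ν.prod (choiceLaw n 6 3)) (⋃ t ∈ Finset.range T,
      {p | 3 / 4 * (n : ℝ) ≤ (A.usefulSets x₀ p t).card ∧
        ((A.usefulSets x₀ p (t + 1)).card : ℝ) < 3 / 4 * n}) := by
        refine measure_mono fun p hp => ?_
        obtain ⟨t, ht, hlt⟩ := hp
        -- the first round without enough useful servers is not round `0`
        have hex : ∃ t, ((A.usefulSets x₀ p t).card : ℝ) < 3 / 4 * n := ⟨t, hlt⟩
        classical
        have hmin := Nat.find_spec hex
        have hle : Nat.find hex ≤ t := Nat.find_min' hex hlt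
        rcases hr : Nat.find hex with _ | r
        · rw [hr] at hmin
          exact absurd (hAb.le_card_usefulSets_zero x₀ p) (not_le.2 hmin)
        · rw [hr] at hmin hle
          refine Set.mem_iUnion₂.2 ⟨r, Finset.mem_range.2 (by omega), ?_, hmin⟩
          exact not_lt.1 (Nat.find_min hex (m := r) (by omega))
    _ ≤ ∑ t ∈ Finset.range T, ENNReal.ofReal ε :=
        (measure_biUnion_finset_le _ _).trans (Finset.sum_le_sum fun t _ =>
          hA.measure_availability_lost_le hAb ν x₀ t hε hε0)
    _ = ENNReal.ofReal (T * ε) := by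
        rw [Finset.sum_const, Finset.card_range, nsmul_eq_mul, ← ENNReal.ofReal_natCast,
          ← ENNReal.ofReal_mul (Nat.cast_nonneg T)]

end Execution

theorem contraction_pow_mul_le {c : ℝ} {n : ℕ} (hn : 0 < n) {τ : ℕ}
    (hτ : 4000 * (c + 4) * Real.log n ≤ τ) :
    (1 - 1 / 4000 : ℝ) ^ τ * n ^ 4 ≤ (n : ℝ) ^ (-c) := by
  have hn' : (0 : ℝ) < n := by exact_mod_cast hn
  have h1 : (1 - 1 / 4000 : ℝ) ^ τ ≤ (n : ℝ) ^ (-(c + 4)) := by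
    calc (1 - 1 / 4000 : ℝ) ^ τ ≤ (Real.exp (-(1 / 4000))) ^ τ := by
          gcongr
          linarith [Real.add_one_le_exp (-(1 / 4000 : ℝ))]
      _ = Real.exp (τ * -(1 / 4000)) := (Real.exp_nat_mul _ _).symm
      _ ≤ Real.exp (Real.log n * -(c + 4)) := Real.exp_le_exp.2 (by linarith)
      _ = (n : ℝ) ^ (-(c + 4)) := (Real.rpow_def_of_pos hn' _).symm
  calc (1 - 1 / 4000 : ℝ) ^ τ * n ^ 4 ≤ (n : ℝ) ^ (-(c + 4)) * (n : ℝ) ^ (4 : ℝ) := by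
        rw [show ((n : ℝ) ^ (4 : ℝ)) = (n : ℝ) ^ 4 by exact_mod_cast Real.rpow_natCast (n : ℝ) 4]
        gcongr
    _ = (n : ℝ) ^ (-c) := by rw [← Real.rpow_add hn']; congr 1; ring

theorem exists_pow_mul_pow_half_le {θ : ℝ} (h0 : 0 < θ) (h1 : θ < 1) (c : ℝ) (d : ℕ) :
    ∃ n₀ : ℕ, ∀ n : ℕ, n₀ ≤ n → ((n ^ d : ℕ) : ℝ) * θ ^ (n / 2) ≤ (n : ℝ) ^ (-c) := by
  obtain ⟨m, hm⟩ := exists_nat_ge c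
  have hlim : Filter.Tendsto (fun r : ℕ => (3 : ℝ) ^ (d + m) * ((r : ℝ) ^ (d + m) * θ ^ r))
      Filter.atTop (nhds 0) := by
    simpa using (tendsto_pow_const_mul_const_pow_of_abs_lt_one (d + m)
      (by rwa [abs_of_pos h0])).const_mul ((3 : ℝ) ^ (d + m))
  obtain ⟨r₀, hr₀⟩ := Filter.eventually_atTop.1 (hlim.eventually_le_const one_pos)
  refine ⟨2 * r₀ + 2, fun n hn => ?_⟩
  have hn' : (1 : ℝ) ≤ n := by exact_mod_cast (by omega : 1 ≤ n)
  have hr := hr₀ (n / 2) (by omega)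
  have h3 : (n : ℝ) ≤ 3 * ((n / 2 : ℕ) : ℝ) := by exact_mod_cast (by omega : n ≤ 3 * (n / 2))
  have h4 : (n : ℝ) ^ (d + m) * θ ^ (n / 2) ≤ 1 := by
    refine le_trans ?_ hr
    rw [← mul_assoc, ← mul_pow]
    gcongr
  have h5 : (n : ℝ) ^ (-(m : ℝ)) ≤ (n : ℝ) ^ (-c) :=
    Real.rpow_le_rpow_of_exponent_le hn' (by linarith)
  refine le_trans ?_ h5
  rw [Real.rpow_neg (by linarith), Real.rpow_natCast, ← one_div, le_div_iff₀ (by positivity)]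
  calc _ = (n : ℝ) ^ (d + m) * θ ^ (n / 2) := by push_cast; ring
    _ ≤ 1 := h4

end MedianConsensus

theorem mainTheorem4 :
    -- Stabilizing consensus in `O(log n)` rounds, w.h.p., against every 1-late adversary,
    -- as long as at least `n / 4` servers are useful in each round.
    (∀ c : ℝ, 0 < c → ∃ C : ℝ, 0 < C ∧ ∃ n₀ : ℕ, ∀ (n : ℕ) [NeZero n], n₀ ≤ n →
      ∀ (K : Type*) [LinearOrder K] (x₀ : Fin n → K)
        (S : Type*) [MeasurableSpace S] (ν : MeasureTheory.Measure S)
        [MeasureTheory.IsProbabilityMeasure ν]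
        (A : MedianConsensus.Adversary S n 6 3), A.IsLate 1 →
        (ν.prod (MedianConsensus.choiceLaw n 6 3))
          {p | ∃ T : ℕ, C * Real.log n ≤ T ∧
            (∀ t ≤ T, (n : ℝ) / 4 ≤ ((A.usefulSets x₀ p t).card : ℝ)) ∧
            ¬ MedianConsensus.SolvesStabilizingConsensus
                (A.states x₀ p) (A.usefulSets x₀ p) (C * Real.log n) (1 / 4) T}
          ≤ ENNReal.ofReal ((n : ℝ) ^ (-c))) ∧
    -- Against every 1-late 1/10-blocking adversary, at least `3 / 4` of the servers are useful
    -- in polynomially many rounds, w.h.p.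
    (∀ c : ℝ, 0 < c → ∀ d : ℕ, ∃ n₀ : ℕ, ∀ (n : ℕ) [NeZero n], n₀ ≤ n →
      ∀ (K : Type*) [LinearOrder K] (x₀ : Fin n → K)
        (S : Type*) [MeasurableSpace S] (ν : MeasureTheory.Measure S)
        [MeasureTheory.IsProbabilityMeasure ν]
        (A : MedianConsensus.Adversary S n 6 3), A.IsLate 1 → A.IsBlocking (1 / 10) →
        (ν.prod (MedianConsensus.choiceLaw n 6 3))
          {p | ∃ t : ℕ, t ≤ n ^ d ∧ ((A.usefulSets x₀ p t).card : ℝ) < 3 / 4 * n}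
          ≤ ENNReal.ofReal ((n : ℝ) ^ (-c))) := by
  constructor
  · intro c hc
    refine ⟨4000 * (c + 4), by positivity, 400, ?_⟩
    intro n _ hn K _ x₀ S _ ν _ A hA
    refine le_trans (measure_mono fun p hp => ?_)
      ((hA.measure_no_agreement_le ν hn x₀ ⌈4000 * (c + 4) * Real.log n⌉₊).trans
        (ENNReal.ofReal_le_ofReal
          (MedianConsensus.contraction_pow_mul_le (by omega) (Nat.le_ceil _))))
    obtain ⟨T, hT, hU, hnot⟩ := hp
    refine ⟨fun t ht => hU t (ht.trans (Nat.ceil_le.2 hT)), fun hagree => hnot ?_⟩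
    refine MedianConsensus.solvesStabilizingConsensus_of_agreement x₀ _ _ hagree fun t ht => ?_
    rw [one_div_mul_eq_div]
    exact hU t ht
  · intro c _ d
    obtain ⟨θ, hθ0, hθ1, hθ⟩ := MedianConsensus.exists_card_few_active_le
    obtain ⟨n₀, hn₀⟩ := MedianConsensus.exists_pow_mul_pow_half_le hθ0 hθ1 c d
    refine ⟨n₀, ?_⟩
    intro n _ hn K _ x₀ S _ ν _ A hA hAb
    exact (hA.measure_availability_le hAb ν x₀ (n ^ d) (hθ n K) (by positivity)).trans
      (ENNReal.ofReal_le_ofReal (hn₀ n hn))
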